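/- A $v\times t$ matrix with entries in $\{0,1\}$ is a \emph{BIBD incidence matrix} (incidence matrix of a balanced incomplete block design) if there are positive integers $k$ and $\lambda$ such that every column has exactly $k$ entries equal to $1$ and every two distinct rows have inner product $\lambda$. Let $v,k$ be fixed integers with $k\ge 2$ and $v-k\ge 2$, let $d=\binom{v}{2}$, let $\Psi_{v,k,t}$ be the number of BIBD incidence matrices of dimensions $v\times t$ with exactly $k$ ones in each column, and let \[ f(v,k)=2\left(\frac{(k-1)(v-k-1)}{v-3}\right)^{d-v}\left(\frac{k(v-k)}{v-2}\right)^{d-1}\left(\frac{1}{v(v-1)}\right)^{d}. \] Then, as $t\to\infty$ through the positive integers $t$ with $t\frac{k}{v}\in\mathbb Z$ and $t\frac{k(k-1)}{v(v-1)}\in\mathbb Z$, \[ \Psi_{v,k,t}=[1+o(1)]\,\frac{\binom{v}{k}^{t}}{\sqrt{(2\pi t)^{d-1}f(v,k)}}. \] -/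

import Mathlib

/-- The number of 1's in column `j` of a matrix. -/
def columnOnes {v t : ℕ} (A : Matrix (Fin v) (Fin t) ℕ) (j : Fin t) : ℕ :=
  (Finset.univ.filter fun i : Fin v => A i j = 1).card

/-- A `v × t` matrix of 0's and 1's is an incidence matrix of a balanced incomplete block
design if there are positive integers `k` and `l` such that every column has exactly `k` 1's
and any two distinct rows have inner product `l`. -/
def IsBIBDIncidenceMatrix {v t : ℕ} (A : Matrix (Fin v) (Fin t) ℕ) : Prop :=
  (∀ i j, A i j = 0 ∨ A i j = 1) ∧
    ∃ k l : ℕ, 0 < k ∧ 0 < l ∧ (∀ j, columnOnes A j = k) ∧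
      ∀ i i' : Fin v, i ≠ i' → dotProduct (A i) (A i') = l

/-- The set of BIBD incidence matrices of dimensions `v × t` with `k` 1's in each column. -/
def bibdMatrices (v k t : ℕ) : Set (Matrix (Fin v) (Fin t) ℕ) :=
  {A | IsBIBDIncidenceMatrix A ∧ ∀ j, columnOnes A j = k}

/-- This set is finite, so that its `Set.ncard` is its true cardinality. -/
theorem bibdMatrices_finite (v k t : ℕ) : (bibdMatrices v k t).Finite := by
  have h : (Set.univ.pi fun _ : Fin v => Set.univ.pi fun _ : Fin t => ({0, 1} : Set ℕ)).Finite :=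
    Set.Finite.pi fun _ => Set.Finite.pi fun _ => Set.toFinite _
  refine h.subset fun A hA => ?_
  simp only [Set.mem_pi, Set.mem_univ, true_implies]
  exact fun i j => hA.1.1 i j

/-- The number `Ψ_{v,k,t}` of BIBD incidence matrices of dimensions `v × t` with `k` 1's in
each column. -/
noncomputable def bibdCount (v k t : ℕ) : ℕ := (bibdMatrices v k t).ncard

/-- The constant `f(v,k)`, with `d = v.choose 2`; the exponents are integers. -/
noncomputable def bibdConst (v k : ℕ) : ℝ :=
  2 * (((k : ℝ) - 1) * ((v : ℝ) - k - 1) / ((v : ℝ) - 3)) ^ ((v.choose 2 : ℤ) - (v : ℤ))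
    * ((k : ℝ) * ((v : ℝ) - k) / ((v : ℝ) - 2)) ^ ((v.choose 2 : ℤ) - 1)
    * (1 / ((v : ℝ) * ((v : ℝ) - 1))) ^ (v.choose 2)

/-- The numbers `t` of columns for which `t k / v` and `t k (k - 1) / (v (v - 1))` are both
integers. -/
def admissibleColumns (v k : ℕ) : Set ℕ :=
  {t | (∃ r : ℤ, (t : ℚ) * ((k : ℚ) / v) = r) ∧
    ∃ l : ℤ, (t : ℚ) * ((k : ℚ) * ((k : ℚ) - 1) / ((v : ℚ) * ((v : ℚ) - 1))) = l}

/-! The columns of a design are `t` blocks, that is `k`-subsets of the point set, so the count is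
`(v choose k)^t` times the probability that `t` independent uniform blocks cover every pair equally
often. This is a return probability of a lattice random walk, and the formula is its local limit
theorem.

The coordinates of the walk must be chosen with care. The indicators of the `d` pairs sum to `k
choose 2` on every block, so their covariance is singular. Their sum over the pairs through a point
`i` is `k - 1` times the indicator of `i`, so for `k > 2` the dual of the lattice of differences is
larger than `2πℤ^ι`, even after one pair is dropped. Both defects disappear if one fixes a point `h`
and a pair `e₀` avoiding it, drops `e₀`, and replaces each pair `{h, i}` by the point `i`. These `d
- 1` centred coordinates (`pairVector`) vanish on a word exactly for a design
(`forall_sum_pairVector_eq_zero_iff`) and are aperiodic (`isAperiodic_pairVector`).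

For an aperiodic centred step, Fourier inversion writes the count as the integral over a box of the
`t`-th power of the characteristic function. Under the scaling `θ = u/√t` the integrand tends to a
Gaussian. A bound `1 - c|θ|²` for the squared modulus on the whole box gives domination
(`IsAperiodic.isEquivalent_card_sum_eq_zero`).

It remains to show that the covariance determinant is `f(v,k)`. The second moments of the full
family of pair indicators depend only on the size of the intersection of two pairs, so that
determinant is a product of three eigenvalue powers. An explicit change of coordinates carries it to
the covariance (`det_secondMoment_pairVector`). -/

open MeasureTheory Filter Topology Matrix

/-! ### Gaussian integrals and positive definite forms -/

section GaussianIntegral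

variable {ι : Type*} [Fintype ι]

open scoped MatrixOrder Matrix.Norms.L2Operator in
theorem Matrix.PosDef.exists_transpose_mul_self [DecidableEq ι] {A : Matrix ι ι ℝ} (hA : A.PosDef) :
    ∃ B : Matrix ι ι ℝ, A = Bᵀ * B := by
  have h := Matrix.nonneg_iff_posSemidef.mpr hA.posSemidef
  obtain ⟨B, hB⟩ := CStarAlgebra.nonneg_iff_eq_star_mul_self.mp h
  exact ⟨B, by rw [hB, Matrix.star_eq_conjTranspose, Matrix.conjTranspose_eq_transpose_of_trivial]⟩

theorem integral_exp_neg_half_dotProduct_self :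
    ∫ u : ι → ℝ, Real.exp (-(u ⬝ᵥ u) / 2) = √(2 * Real.pi) ^ Fintype.card ι := by
  have h : ∀ u : ι → ℝ, Real.exp (-(u ⬝ᵥ u) / 2) = ∏ i, Real.exp (-(1 / 2) * u i ^ 2) := by
    intro u
    rw [← Real.exp_sum, dotProduct, ← Finset.sum_neg_distrib, Finset.sum_div]
    congr 1
    exact Finset.sum_congr rfl fun i _ => by ring
  simp_rw [h]
  rw [integral_fintype_prod_volume_eq_pow (fun x : ℝ => Real.exp (-(1 / 2) * x ^ 2)),
    integral_gaussian]
  congr 2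
  ring

/-- Factor `A = Bᵀ B` and substitute `B u`; the Jacobian is `|det B| = √(det A)`. -/
theorem integral_exp_neg_half_quadratic [DecidableEq ι] {A : Matrix ι ι ℝ} (hA : A.PosDef) :
    ∫ u : ι → ℝ, Real.exp (-(u ⬝ᵥ A *ᵥ u) / 2) = √(2 * Real.pi) ^ Fintype.card ι / √A.det := by
  obtain ⟨B, hB⟩ := hA.exists_transpose_mul_self
  have hdet : A.det = B.det ^ 2 := by rw [hB, det_mul, det_transpose, sq]
  have hB0 : B.det ≠ 0 := fun h => by
    have := hA.det_pos
    rw [hdet, h] at this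
    simp at this
  have hq : ∀ u : ι → ℝ, u ⬝ᵥ A *ᵥ u = toLin' B u ⬝ᵥ toLin' B u := by
    intro u
    rw [hB, toLin'_apply, ← mulVec_mulVec, dotProduct_mulVec, vecMul_transpose]
  simp_rw [hq]
  have hcont : Continuous (toLin' B) := LinearMap.continuous_of_finiteDimensional _
  have hm := integral_map (μ := (volume : Measure (ι → ℝ))) (φ := toLin' B)
    hcont.measurable.aemeasurable (f := fun u => Real.exp (-(u ⬝ᵥ u) / 2))
    (Continuous.aestronglyMeasurable (by simp only [dotProduct]; fun_prop))
  rw [← hm, Real.map_matrix_volume_pi_eq_smul_volume_pi hB0, integral_smul_measure,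
    integral_exp_neg_half_dotProduct_self, hdet, Real.sqrt_sq_eq_abs,
    ENNReal.toReal_ofReal (abs_nonneg _), abs_inv, smul_eq_mul, div_eq_inv_mul]

theorem Matrix.PosDef.exists_pos_mul_sum_sq_le {A : Matrix ι ι ℝ} (hA : A.PosDef) :
    ∃ c : ℝ, 0 < c ∧ ∀ u : ι → ℝ, c * ∑ i, u i ^ 2 ≤ u ⬝ᵥ A *ᵥ u := by
  have hcont : Continuous fun u : ι → ℝ => u ⬝ᵥ A *ᵥ u := by
    simp only [dotProduct, mulVec]; fun_prop
  have hpos : ∀ u : ι → ℝ, u ≠ 0 → 0 < u ⬝ᵥ A *ᵥ u := fun u hu => by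
    simpa using hA.dotProduct_mulVec_pos hu
  have hK : IsCompact {u : ι → ℝ | ∑ i, u i ^ 2 = 1} := by
    refine (isCompact_univ_pi (s := fun _ : ι => Set.Icc (-1 : ℝ) 1)
      fun _ => isCompact_Icc).of_isClosed_subset
      (isClosed_eq (by fun_prop) continuous_const) fun u hu i _ => ?_
    have : u i ^ 2 ≤ 1 := by
      rw [← (show ∑ i, u i ^ 2 = 1 from hu)]
      exact Finset.single_le_sum (f := fun i => u i ^ 2) (fun j _ => sq_nonneg _)
        (Finset.mem_univ i)
    exact abs_le.mp ((sq_le_one_iff_abs_le_one _).mp this)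
  have hscale : ∀ c : ℝ, (∀ u : ι → ℝ, ∑ i, u i ^ 2 = 1 → c ≤ u ⬝ᵥ A *ᵥ u) →
      ∀ u : ι → ℝ, c * ∑ i, u i ^ 2 ≤ u ⬝ᵥ A *ᵥ u := by
    intro c hc u
    rcases eq_or_ne u 0 with rfl | hu
    · simp
    set s := ∑ i, u i ^ 2 with hs
    have hs0 : 0 < s := by
      obtain ⟨i, hi⟩ := Function.ne_iff.mp hu
      exact Finset.sum_pos' (fun j _ => sq_nonneg _) ⟨i, Finset.mem_univ i, sq_pos_of_ne_zero hi⟩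
    have h1 := hc ((√s)⁻¹ • u) (by
      simp only [Pi.smul_apply, smul_eq_mul, mul_pow, ← Finset.mul_sum, ← hs, inv_pow,
        Real.sq_sqrt hs0.le]
      exact inv_mul_cancel₀ hs0.ne')
    rw [mulVec_smul, smul_dotProduct, dotProduct_smul, smul_smul, ← mul_inv,
      Real.mul_self_sqrt hs0.le, smul_eq_mul, ← div_eq_inv_mul, le_div_iff₀ hs0] at h1
    exact h1
  rcases Set.eq_empty_or_nonempty {u : ι → ℝ | ∑ i, u i ^ 2 = 1} with he | hne
  · refine ⟨1, one_pos, hscale 1 fun u hu => ?_⟩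
    have : u ∈ {u : ι → ℝ | ∑ i, u i ^ 2 = 1} := hu
    simp [he] at this
  · obtain ⟨u₀, hu₀, hmin⟩ := hK.exists_isMinOn hne hcont.continuousOn
    refine ⟨_, hpos u₀ ?_, hscale _ fun u hu => hmin hu⟩
    rintro rfl
    simp at hu₀

end GaussianIntegral

/-! ### Characteristic functions of aperiodic steps -/

section LocalLimit

variable {ι Ω : Type*} [Fintype ι] [Fintype Ω]

/-- The characteristic function of the uniform distribution on the points `Y ω`. -/
noncomputable def charSum (Y : Ω → ι → ℝ) (θ : ι → ℝ) : ℂ :=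
  (∑ ω, Complex.exp ((θ ⬝ᵥ Y ω : ℝ) * Complex.I)) / Fintype.card Ω

/-- The matrix of second moments of the uniform distribution on the points `Y ω`. -/
noncomputable def secondMoment (Y : Ω → ι → ℝ) : Matrix ι ι ℝ :=
  Matrix.of fun i j => (∑ ω, Y ω i * Y ω j) / Fintype.card Ω

/-- The differences of the points `Y ω` generate a lattice whose dual is `ℤ ^ ι`. -/
def IsAperiodic (Y : Ω → ι → ℝ) : Prop :=
  ∀ θ : ι → ℝ, (∀ ω ω', ∃ n : ℤ, θ ⬝ᵥ Y ω - θ ⬝ᵥ Y ω' = n * (2 * Real.pi)) →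
    ∀ i, ∃ n : ℤ, θ i = n * (2 * Real.pi)

theorem continuous_charSum (Y : Ω → ι → ℝ) : Continuous (charSum Y) := by
  unfold charSum
  simp only [dotProduct]
  fun_prop

theorem dotProduct_secondMoment_mulVec (Y : Ω → ι → ℝ) (u : ι → ℝ) :
    u ⬝ᵥ secondMoment Y *ᵥ u = (∑ ω, (u ⬝ᵥ Y ω) ^ 2) / Fintype.card Ω := by
  simp only [dotProduct, mulVec, secondMoment, Matrix.of_apply, sq,
    Finset.mul_sum, Finset.sum_mul, Finset.sum_div]
  rw [Finset.sum_comm_cycle]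
  refine Finset.sum_congr rfl fun ω _ => Finset.sum_congr rfl fun i _ =>
    Finset.sum_congr rfl fun j _ => by ring

theorem norm_charSum_sq (Y : Ω → ι → ℝ) (θ : ι → ℝ) :
    ‖charSum Y θ‖ ^ 2 =
      (∑ ω, ∑ ω', Real.cos (θ ⬝ᵥ Y ω - θ ⬝ᵥ Y ω')) / (Fintype.card Ω : ℝ) ^ 2 := by
  rw [charSum, norm_div, div_pow, Complex.norm_natCast, ← Complex.normSq_eq_norm_sq,
    Complex.normSq_apply]
  congr 1
  simp only [Complex.re_sum, Complex.im_sum, Complex.exp_ofReal_mul_I_re,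
    Complex.exp_ofReal_mul_I_im, Finset.sum_mul_sum, ← Finset.sum_add_distrib, Real.cos_sub]

theorem sum_sum_sub_sq (x : Ω → ℝ) (hx : ∑ ω, x ω = 0) :
    ∑ ω, ∑ ω', (x ω - x ω') ^ 2 = 2 * Fintype.card Ω * ∑ ω, x ω ^ 2 := by
  have : ∀ ω ω', (x ω - x ω') ^ 2 = x ω ^ 2 + x ω' ^ 2 - 2 * (x ω * x ω') := fun _ _ => by ring
  simp only [this, Finset.sum_sub_distrib, Finset.sum_add_distrib, ← Finset.mul_sum,
    ← Finset.sum_mul, hx, Finset.sum_const, Finset.card_univ, nsmul_eq_mul]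
  ring

variable {Y : Ω → ι → ℝ}

theorem sum_dotProduct_eq_zero (h0 : ∀ i, ∑ ω, Y ω i = 0) (u : ι → ℝ) :
    ∑ ω, u ⬝ᵥ Y ω = 0 := by
  simp only [dotProduct]
  rw [Finset.sum_comm]
  simp [← Finset.mul_sum, h0]

/-- A null vector of the form is orthogonal to every step, so all its real multiples would satisfy
the hypothesis of aperiodicity. -/
theorem IsAperiodic.posDef_secondMoment [Nonempty Ω] (ha : IsAperiodic Y) :
    (secondMoment Y).PosDef := by
  refine Matrix.PosDef.of_dotProduct_mulVec_pos ?_ fun u hu => ?_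
  · ext i j
    simp [secondMoment, mul_comm]
  · rw [star_trivial, dotProduct_secondMoment_mulVec]
    refine div_pos ?_ (by exact_mod_cast Fintype.card_pos)
    by_contra hcon
    have hz : ∑ ω, (u ⬝ᵥ Y ω) ^ 2 = 0 :=
      le_antisymm (not_lt.mp hcon) (Finset.sum_nonneg fun _ _ => sq_nonneg _)
    have hz' : ∀ ω, u ⬝ᵥ Y ω = 0 := fun ω => by
      simpa using (Finset.sum_eq_zero_iff_of_nonneg fun _ _ => sq_nonneg _).mp hz ω
        (Finset.mem_univ ω)
    obtain ⟨i, hi⟩ := Function.ne_iff.mp hu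
    -- The multiple is scaled so that its `i`-th coordinate is `π`, which is not in `2πℤ`.
    obtain ⟨n, hn⟩ := ha ((Real.pi / u i) • u)
      (fun ω ω' => ⟨0, by simp [smul_dotProduct, hz']⟩) i
    rw [Pi.smul_apply, smul_eq_mul, div_mul_cancel₀ _ hi] at hn
    have h2 : (1 : ℝ) = 2 * n :=
      mul_right_cancel₀ Real.pi_ne_zero (by linarith)
    have h3 : (1 : ℤ) = 2 * n := by exact_mod_cast h2
    omega

/-- Otherwise every cosine in `norm_charSum_sq` equals 1, so the phases agree modulo `2π` and `θ`
lies in `2πℤ^ι`, which meets the box only at 0. -/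
theorem IsAperiodic.norm_charSum_sq_lt_one [Nonempty Ω] (ha : IsAperiodic Y) {θ : ι → ℝ}
    (hθ : ∀ i, |θ i| ≤ Real.pi) (hθ0 : θ ≠ 0) : ‖charSum Y θ‖ ^ 2 < 1 := by
  have hN : (0 : ℝ) < Fintype.card Ω := by exact_mod_cast Fintype.card_pos
  rw [norm_charSum_sq, div_lt_one (by positivity)]
  by_contra hcon
  have hsum : ∑ ω : Ω, ∑ ω' : Ω, (1 - Real.cos (θ ⬝ᵥ Y ω - θ ⬝ᵥ Y ω')) ≤ 0 := by
    simp only [Finset.sum_sub_distrib, Finset.sum_const, Finset.card_univ, nsmul_eq_mul]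
    nlinarith [not_lt.mp hcon]
  have hnn : ∀ ω ω', 0 ≤ 1 - Real.cos (θ ⬝ᵥ Y ω - θ ⬝ᵥ Y ω') := fun ω ω' => by
    linarith [Real.cos_le_one (θ ⬝ᵥ Y ω - θ ⬝ᵥ Y ω')]
  have hz := le_antisymm hsum
    (Finset.sum_nonneg fun ω _ => Finset.sum_nonneg fun ω' _ => hnn ω ω')
  apply hθ0
  funext i
  obtain ⟨n, hn⟩ := ha θ (fun ω ω' => by
    have h1 := (Finset.sum_eq_zero_iff_of_nonneg fun ω _ =>
      Finset.sum_nonneg fun ω' _ => hnn ω ω').mp hz ω (Finset.mem_univ ω)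
    have h2 := (Finset.sum_eq_zero_iff_of_nonneg fun ω' _ => hnn ω ω').mp h1 ω'
      (Finset.mem_univ ω')
    obtain ⟨n, hn⟩ := (Real.cos_eq_one_iff _).mp (sub_eq_zero.mp h2).symm
    exact ⟨n, hn.symm⟩) i
  have h1 := hθ i
  rw [hn, abs_mul, abs_of_pos Real.two_pi_pos] at h1
  have h2 : |(n : ℝ)| < 1 := by nlinarith [Real.pi_pos, abs_nonneg (n : ℝ)]
  have h3 : |n| < 1 := by exact_mod_cast h2
  rw [hn, Int.abs_lt_one_iff.mp h3]
  simp

/-- Where all phase differences are below `π`, the inequality `cos x ≤ 1 - 2x²/π²` reduces the bound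
to positive definiteness. The rest of the box is compact and avoids 0, so there the modulus stays
away from 1. -/
theorem IsAperiodic.exists_norm_charSum_sq_le [Nonempty Ω] (ha : IsAperiodic Y)
    (h0 : ∀ i, ∑ ω, Y ω i = 0) : ∃ c : ℝ, 0 < c ∧
      ∀ θ : ι → ℝ, (∀ i, |θ i| ≤ Real.pi) → ‖charSum Y θ‖ ^ 2 ≤ 1 - c * ∑ i, θ i ^ 2 := by
  classical
  have hN : (0 : ℝ) < Fintype.card Ω := by exact_mod_cast Fintype.card_pos
  obtain ⟨c₁, hc₁, hq⟩ := ha.posDef_secondMoment.exists_pos_mul_sum_sq_le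
  set U : Set (ι → ℝ) := {θ | ∀ ω ω', |θ ⬝ᵥ Y ω - θ ⬝ᵥ Y ω'| < Real.pi} with hU
  have hUo : IsOpen U := by
    simp only [hU, Set.ofPred_forall]
    refine isOpen_iInter_of_finite fun ω => isOpen_iInter_of_finite fun ω' => ?_
    exact isOpen_lt (by simp only [dotProduct]; fun_prop) continuous_const
  have hnear : ∀ θ ∈ U, ‖charSum Y θ‖ ^ 2 ≤ 1 - (4 / Real.pi ^ 2 * c₁) * ∑ i, θ i ^ 2 := by
    intro θ hθ
    have h1 := hq θ
    rw [dotProduct_secondMoment_mulVec] at h1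
    have h2 : ∑ ω, ∑ ω', Real.cos (θ ⬝ᵥ Y ω - θ ⬝ᵥ Y ω') ≤
        ∑ ω : Ω, ∑ ω' : Ω, (1 - 2 / Real.pi ^ 2 * (θ ⬝ᵥ Y ω - θ ⬝ᵥ Y ω') ^ 2) :=
      Finset.sum_le_sum fun ω _ => Finset.sum_le_sum fun ω' _ =>
        Real.cos_le_one_sub_mul_cos_sq (hθ ω ω').le
    simp only [Finset.sum_sub_distrib, ← Finset.mul_sum, Finset.sum_const, Finset.card_univ,
      nsmul_eq_mul, mul_one, sum_sum_sub_sq _ (sum_dotProduct_eq_zero h0 θ)] at h2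
    rw [norm_charSum_sq, div_le_iff₀ (by positivity)]
    refine h2.trans ?_
    rw [le_div_iff₀ hN] at h1
    have h3 := mul_le_mul_of_nonneg_left h1
      (show 0 ≤ 4 / Real.pi ^ 2 * Fintype.card Ω by positivity)
    have e1 : 2 / Real.pi ^ 2 * (2 * Fintype.card Ω * ∑ ω, (θ ⬝ᵥ Y ω) ^ 2) =
      4 / Real.pi ^ 2 * Fintype.card Ω * ∑ ω, (θ ⬝ᵥ Y ω) ^ 2 := by ring
    rw [e1]
    nlinarith [h3]
  set K : Set (ι → ℝ) := (Set.univ.pi fun _ => Set.Icc (-Real.pi) Real.pi) \ U with hK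
  have hKc : IsCompact K := (isCompact_univ_pi fun _ => isCompact_Icc).diff hUo
  obtain ⟨M, hM, hfar⟩ : ∃ M : ℝ, M < 1 ∧ ∀ θ ∈ K, ‖charSum Y θ‖ ^ 2 ≤ M := by
    rcases K.eq_empty_or_nonempty with he | hne
    · exact ⟨0, one_pos, by simp [he]⟩
    obtain ⟨θ₀, hθ₀, hmax⟩ := hKc.exists_isMaxOn hne
      ((continuous_charSum Y).norm.pow 2).continuousOn
    refine ⟨_, ha.norm_charSum_sq_lt_one (θ := θ₀)
      (fun i => abs_le.mpr (hθ₀.1 i (Set.mem_univ i))) ?_, fun θ hθ => hmax hθ⟩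
    rintro rfl
    exact hθ₀.2 fun ω ω' => by simpa using Real.pi_pos
  -- An upper bound for `∑ θ i ^ 2` on the box; the added 1 keeps it positive when `ι` is empty.
  set D : ℝ := Fintype.card ι * Real.pi ^ 2 + 1 with hD
  have hDpos : 0 < D := by positivity
  have hDle : ∀ θ : ι → ℝ, (∀ i, |θ i| ≤ Real.pi) → ∑ i, θ i ^ 2 ≤ D := fun θ hθ => by
    have : ∑ i, θ i ^ 2 ≤ ∑ _i : ι, Real.pi ^ 2 := Finset.sum_le_sum fun i _ => by
      rw [← sq_abs]
      exact pow_le_pow_left₀ (abs_nonneg _) (hθ i) 2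
    simp only [Finset.sum_const, Finset.card_univ, nsmul_eq_mul] at this
    linarith
  refine ⟨min (4 / Real.pi ^ 2 * c₁) ((1 - M) / D),
    lt_min (by positivity) (div_pos (by linarith) hDpos), fun θ hθ => ?_⟩
  have hs : 0 ≤ ∑ i, θ i ^ 2 := Finset.sum_nonneg fun _ _ => sq_nonneg _
  by_cases hθU : θ ∈ U
  · refine (hnear θ hθU).trans ?_
    gcongr
    exact min_le_left _ _
  · refine (hfar θ ⟨fun i _ => abs_le.mp (hθ i), hθU⟩).trans ?_
    have h1 : min (4 / Real.pi ^ 2 * c₁) ((1 - M) / D) * ∑ i, θ i ^ 2 ≤ (1 - M) / D * D :=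
      mul_le_mul (min_le_right _ _) (hDle θ hθ) hs (div_nonneg (by linarith) hDpos.le)
    rw [div_mul_cancel₀ _ hDpos.ne'] at h1
    linarith

end LocalLimit

/-! ### Local limit theorem -/

section LocalLimit

variable {ι Ω : Type*} [Fintype ι] [Fintype Ω] {Y : Ω → ι → ℝ}

theorem tendsto_nat_mul_exp_sub_one_sub (y : ℝ) :
    Tendsto (fun t : ℕ => (t : ℂ) * (Complex.exp (((√t)⁻¹ * y : ℝ) * Complex.I) - 1 -
      ((√t)⁻¹ * y : ℝ) * Complex.I)) atTop (𝓝 (-(y : ℂ) ^ 2 / 2)) := by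
  set x : ℕ → ℂ := fun t => ((√t)⁻¹ * y : ℝ) * Complex.I with hx
  have hr : Tendsto (fun t : ℕ => (√(t : ℝ))⁻¹ * y) atTop (𝓝 0) := by
    have := (tendsto_inv_atTop_zero.comp
      (Real.tendsto_sqrt_atTop.comp tendsto_natCast_atTop_atTop)).mul_const y
    simpa using this
  have hx0 : Tendsto x atTop (𝓝 0) := by
    have := ((Complex.continuous_ofReal.tendsto 0).comp hr).mul_const Complex.I
    rw [Complex.ofReal_zero, zero_mul] at this
    exact this
  have hsq : ∀ t : ℕ, 0 < t → (t : ℂ) * x t ^ 2 = -(y : ℂ) ^ 2 := by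
    intro t ht
    have h1 : ((√(t : ℝ) : ℝ) : ℂ) ^ 2 = t := by
      rw [← Complex.ofReal_pow, Real.sq_sqrt (Nat.cast_nonneg t), Complex.ofReal_natCast]
    have h2 : (t : ℂ) ≠ 0 := by exact_mod_cast ht.ne'
    simp only [hx, Complex.ofReal_mul, Complex.ofReal_inv, mul_pow, inv_pow, h1, Complex.I_sq]
    field_simp
  have ho := (Complex.exp_sub_sum_range_succ_isLittleO_pow 2).comp_tendsto hx0
  have ho2 : (fun t : ℕ => (t : ℂ) * (Complex.exp (x t) - ∑ i ∈ Finset.range (2 + 1),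
      x t ^ i / i.factorial)) =o[atTop] fun t : ℕ => (t : ℂ) * x t ^ 2 :=
    (Asymptotics.isBigO_refl (fun t : ℕ => (t : ℂ)) atTop).mul_isLittleO ho
  have hlim : Tendsto (fun t : ℕ => (t : ℂ) * x t ^ 2) atTop (𝓝 (-(y : ℂ) ^ 2)) :=
    tendsto_const_nhds.congr' ((eventually_gt_atTop 0).mono fun t ht => (hsq t ht).symm)
  have h0 := ho2.trans_isBigO (hlim.isBigO_one ℂ)
  rw [Asymptotics.isLittleO_one_iff] at h0
  have h3 := h0.add (hlim.div_const 2)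
  rw [zero_add] at h3
  refine h3.congr fun t => ?_
  simp only [Finset.sum_range_succ, Finset.sum_range_zero, Nat.factorial]
  change _ = (t : ℂ) * (Complex.exp (x t) - 1 - x t)
  push_cast
  ring

/-- Second-order Taylor expansion of each exponential; the linear terms cancel because the steps are
centred. -/
theorem tendsto_charSum_pow [Nonempty Ω] (h0 : ∀ i, ∑ ω, Y ω i = 0) (u : ι → ℝ) :
    Tendsto (fun t : ℕ => charSum Y ((√(t : ℝ))⁻¹ • u) ^ t) atTop
      (𝓝 (Real.exp (-(u ⬝ᵥ secondMoment Y *ᵥ u) / 2) : ℝ)) := by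
  have hN : (Fintype.card Ω : ℂ) ≠ 0 := by exact_mod_cast Fintype.card_ne_zero
  have h1 : Tendsto (fun t : ℕ => (t : ℂ) * (charSum Y ((√(t : ℝ))⁻¹ • u) - 1)) atTop
      (𝓝 ((-(u ⬝ᵥ secondMoment Y *ᵥ u) / 2 : ℝ) : ℂ)) := by
    have h2 := (tendsto_finsetSum Finset.univ fun ω _ =>
      tendsto_nat_mul_exp_sub_one_sub (u ⬝ᵥ Y ω)).div_const (Fintype.card Ω : ℂ)
    have e : (∑ ω, -((u ⬝ᵥ Y ω : ℝ) : ℂ) ^ 2 / 2) / (Fintype.card Ω : ℂ) =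
        ((-(u ⬝ᵥ secondMoment Y *ᵥ u) / 2 : ℝ) : ℂ) := by
      rw [dotProduct_secondMoment_mulVec]
      push_cast
      rw [← Finset.sum_div, Finset.sum_neg_distrib]
      ring
    rw [e] at h2
    refine h2.congr fun t => ?_
    have hz : ∑ ω, (((√(t : ℝ))⁻¹ * (u ⬝ᵥ Y ω) : ℝ) : ℂ) * Complex.I = 0 := by
      rw [← Finset.sum_mul, ← Complex.ofReal_sum, ← Finset.mul_sum, sum_dotProduct_eq_zero h0]
      simp
    rw [← Finset.mul_sum, Finset.sum_sub_distrib, Finset.sum_sub_distrib, hz, charSum]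
    simp only [smul_dotProduct, smul_eq_mul, Finset.sum_const, Finset.card_univ, nsmul_eq_mul,
      mul_one, sub_zero]
    rw [div_sub_one hN, mul_div_assoc]
  have h3 := Complex.tendsto_one_add_pow_exp_of_tendsto h1
  rw [← Complex.ofReal_exp] at h3
  refine h3.congr fun t => ?_
  rw [add_sub_cancel]

theorem integrable_exp_neg_mul_sum_sq {c : ℝ} (hc : 0 < c) :
    Integrable fun u : ι → ℝ => Real.exp (-(c * ∑ i, u i ^ 2)) := by
  have h : (fun u : ι → ℝ => Real.exp (-(c * ∑ i, u i ^ 2))) =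
      fun u => ∏ i, Real.exp (-c * u i ^ 2) := by
    funext u
    rw [← Real.exp_sum, ← Finset.mul_sum, neg_mul]
  rw [h]
  exact Integrable.fintype_prod (f := fun _ x => Real.exp (-c * x ^ 2))
    fun _ => integrable_exp_neg_mul_sq hc

theorem IsAperiodic.tendsto_integral_charSum_pow [Nonempty Ω] [DecidableEq ι]
    (ha : IsAperiodic Y) (h0 : ∀ i, ∑ ω, Y ω i = 0) :
    Tendsto (fun t : ℕ => ((√(t : ℝ) ^ Fintype.card ι : ℝ) : ℂ) *
        ∫ θ in Set.univ.pi fun _ : ι => Set.Ioc (-Real.pi) Real.pi, charSum Y θ ^ t) atTop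
      (𝓝 ((√(2 * Real.pi) ^ Fintype.card ι / √(secondMoment Y).det : ℝ) : ℂ)) := by
  set box : Set (ι → ℝ) := Set.univ.pi fun _ : ι => Set.Ioc (-Real.pi) Real.pi with hbox
  have hboxm : MeasurableSet box := MeasurableSet.univ_pi fun _ => measurableSet_Ioc
  obtain ⟨c, hc, hle⟩ := ha.exists_norm_charSum_sq_le h0
  have hchar := continuous_charSum Y
  have hlim : Tendsto (fun t : ℕ => ∫ u : ι → ℝ,
      box.indicator (fun θ => charSum Y θ ^ t) ((√(t : ℝ))⁻¹ • u)) atTop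
      (𝓝 (∫ u : ι → ℝ, ((Real.exp (-(u ⬝ᵥ secondMoment Y *ᵥ u) / 2) : ℝ) : ℂ))) := by
    -- The squared modulus is at most `(1 - c|u|²/t)^t ≤ exp(-c|u|²)`; taking the square root halves
    -- `c`.
    refine tendsto_integral_filter_of_dominated_convergence
      (fun u => Real.exp (-(c / 2 * ∑ i, u i ^ 2))) ?_ ?_
      (integrable_exp_neg_mul_sum_sq (by positivity)) ?_
    · refine Eventually.of_forall fun t => ?_
      refine Measurable.aestronglyMeasurable ?_
      exact ((hchar.pow t).measurable.indicator hboxm).comp (measurable_const_smul _)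
    · filter_upwards [eventually_gt_atTop 0] with t ht
      refine ae_of_all _ fun u => ?_
      have ht' : (0 : ℝ) < t := by exact_mod_cast ht
      by_cases hu : (√(t : ℝ))⁻¹ • u ∈ box
      · rw [Set.indicator_of_mem hu, norm_pow]
        refine le_of_sq_le_sq ?_ (Real.exp_pos _).le
        have h1 := hle _ fun i => abs_le.mpr ⟨(hu i (Set.mem_univ i)).1.le,
          (hu i (Set.mem_univ i)).2⟩
        have h2 : c * ∑ i, ((√(t : ℝ))⁻¹ • u) i ^ 2 = c * (∑ i, u i ^ 2) / t := by
          simp only [Pi.smul_apply, smul_eq_mul, mul_pow, ← Finset.mul_sum, inv_pow,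
            Real.sq_sqrt ht'.le]
          ring
        rw [h2] at h1
        rw [← pow_mul, mul_comm, pow_mul, ← Real.exp_nat_mul]
        calc (‖charSum Y ((√(t : ℝ))⁻¹ • u)‖ ^ 2) ^ t
            ≤ Real.exp (-(c * (∑ i, u i ^ 2) / t)) ^ t := by
              refine pow_le_pow_left₀ (sq_nonneg _) (h1.trans ?_) t
              linarith [Real.add_one_le_exp (-(c * (∑ i, u i ^ 2) / t))]
          _ = Real.exp ((2 : ℕ) * -(c / 2 * ∑ i, u i ^ 2)) := by
              rw [← Real.exp_nat_mul]
              congr 1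
              push_cast
              field_simp
      · rw [Set.indicator_of_notMem hu, norm_zero]
        positivity
    · refine ae_of_all _ fun u => ?_
      refine (tendsto_charSum_pow h0 u).congr' ?_
      have hnhds : box ∈ 𝓝 (0 : ι → ℝ) :=
        set_pi_mem_nhds Set.finite_univ fun i _ =>
          Ioc_mem_nhds (by simpa using Real.pi_pos) (by simpa using Real.pi_pos)
      have hr : Tendsto (fun t : ℕ => (√(t : ℝ))⁻¹ • u) atTop (𝓝 0) := by
        have := (tendsto_inv_atTop_zero.comp
          (Real.tendsto_sqrt_atTop.comp tendsto_natCast_atTop_atTop)).smul_const u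
        simpa using this
      filter_upwards [hr.eventually_mem hnhds] with t ht
      rw [Set.indicator_of_mem ht]
  rw [integral_complex_ofReal,
    integral_exp_neg_half_quadratic ha.posDef_secondMoment] at hlim
  refine hlim.congr fun t => ?_
  rw [Measure.integral_comp_smul volume (box.indicator fun θ => charSum Y θ ^ t),
    integral_indicator hboxm, Module.finrank_fintype_fun_eq_card, inv_pow, inv_inv,
    abs_of_nonneg (by positivity)]
  rfl

theorem setIntegral_Ioc_exp_int_mul (n : ℤ) :
    ∫ x in Set.Ioc (-Real.pi) Real.pi, Complex.exp ((x * n : ℝ) * Complex.I) =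
      if n = 0 then (2 * Real.pi : ℂ) else 0 := by
  rw [← intervalIntegral.integral_of_le (by linarith [Real.pi_pos])]
  split_ifs with hn
  · simp [hn]
    ring
  · have hc : (n : ℂ) * Complex.I ≠ 0 := mul_ne_zero (by exact_mod_cast hn) Complex.I_ne_zero
    have := integral_exp_mul_complex (a := -Real.pi) (b := Real.pi) hc
    have e : ∀ x : ℝ, Complex.exp ((x * n : ℝ) * Complex.I) =
        Complex.exp ((n : ℂ) * Complex.I * x) := fun x => by
      congr 1
      push_cast
      ring
    simp_rw [e, this]
    rw [div_eq_zero_iff, sub_eq_zero]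
    left
    rw [Complex.exp_eq_exp_iff_exists_int]
    exact ⟨n, by push_cast; ring⟩

/-- Expanding the power gives one character per word, and orthogonality keeps the words with sum
zero. Integrality is asked only of whole words, since centring makes single letters non-integral in
general. -/
theorem integral_charSum_pow [DecidableEq Ω] (t : ℕ)
    (hint : ∀ w : Fin t → Ω, ∀ i, ∃ n : ℤ, ∑ j, Y (w j) i = n) :
    ∫ θ in Set.univ.pi fun _ : ι => Set.Ioc (-Real.pi) Real.pi, charSum Y θ ^ t =
      (2 * Real.pi : ℂ) ^ Fintype.card ι * (Nat.card {w : Fin t → Ω // ∀ i, ∑ j, Y (w j) i = 0}) /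
        (Fintype.card Ω : ℂ) ^ t := by
  classical
  choose n hn using hint
  have hexp : ∀ θ : ι → ℝ, charSum Y θ ^ t =
      (∑ w : Fin t → Ω, ∏ i, Complex.exp ((θ i * n w i : ℝ) * Complex.I)) /
        (Fintype.card Ω : ℂ) ^ t := by
    intro θ
    rw [charSum, div_pow, Fintype.sum_pow]
    congr 1
    refine Finset.sum_congr rfl fun w _ => ?_
    rw [← Complex.exp_sum, ← Complex.exp_sum, ← Finset.sum_mul, ← Finset.sum_mul,
      ← Complex.ofReal_sum, ← Complex.ofReal_sum]
    congr 3
    simp only [dotProduct]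
    rw [Finset.sum_comm]
    refine Finset.sum_congr rfl fun i _ => ?_
    rw [← Finset.mul_sum, hn]
  have hI : ∀ w : Fin t → Ω, ∫ θ in Set.univ.pi fun _ : ι => Set.Ioc (-Real.pi) Real.pi,
      ∏ i, Complex.exp ((θ i * n w i : ℝ) * Complex.I) =
      if ∀ i, ∑ j, Y (w j) i = 0 then (2 * Real.pi : ℂ) ^ Fintype.card ι else 0 := by
    intro w
    rw [volume_pi, Measure.restrict_pi_pi, integral_fintype_prod_eq_prod
      (f := fun i (x : ℝ) => Complex.exp ((x * n w i : ℝ) * Complex.I))]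
    simp_rw [setIntegral_Ioc_exp_int_mul]
    split_ifs with h
    · have : ∀ i, n w i = 0 := fun i => by
        have := h i
        rw [hn] at this
        exact_mod_cast this
      simp [this]
    · push Not at h
      obtain ⟨i, hi⟩ := h
      refine Finset.prod_eq_zero (Finset.mem_univ i) ?_
      rw [if_neg]
      intro h
      rw [hn, h] at hi
      simp at hi
  have hfin : volume (Set.univ.pi fun _ : ι => Set.Ioc (-Real.pi) Real.pi) ≠ ⊤ := by
    rw [volume_pi, Measure.pi_pi]
    exact ENNReal.prod_ne_top fun i _ => by simp
  simp_rw [hexp]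
  rw [integral_div, integral_finsetSum _ fun w _ => ?_]
  · simp_rw [hI]
    rw [← Finset.sum_filter, Finset.sum_const, nsmul_eq_mul, Nat.card_eq_fintype_card,
      Fintype.card_subtype, mul_comm]
  · have : IsFiniteMeasure (volume.restrict
        (Set.univ.pi fun _ : ι => Set.Ioc (-Real.pi) Real.pi)) :=
      ⟨by rw [Measure.restrict_apply_univ]; exact hfin.lt_top⟩
    refine Integrable.of_bound (C := 1) (Continuous.aestronglyMeasurable (by fun_prop))
      (ae_of_all _ fun θ => ?_)
    rw [norm_prod]
    simp only [Complex.norm_exp_ofReal_mul_I, Finset.prod_const_one, le_refl]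

/-- Local limit theorem for the number of words of length `t` whose letters sum to zero. -/
theorem IsAperiodic.isEquivalent_card_sum_eq_zero [Nonempty Ω] [DecidableEq ι]
    (ha : IsAperiodic Y) (h0 : ∀ i, ∑ ω, Y ω i = 0) {T : Set ℕ}
    (hT : ∀ t ∈ T, ∀ w : Fin t → Ω, ∀ i, ∃ n : ℤ, ∑ j, Y (w j) i = n) :
    Asymptotics.IsEquivalent (atTop ⊓ 𝓟 T)
      (fun t : ℕ => (Nat.card {w : Fin t → Ω // ∀ i, ∑ j, Y (w j) i = 0} : ℝ))
      (fun t : ℕ => (Fintype.card Ω : ℝ) ^ t /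
        √((2 * Real.pi * t) ^ Fintype.card ι * (secondMoment Y).det)) := by
  classical
  have hdet := ha.posDef_secondMoment.det_pos
  have hN : (0 : ℝ) < Fintype.card Ω := by exact_mod_cast Fintype.card_pos
  have h2pi : (0 : ℝ) < √(2 * Real.pi) := Real.sqrt_pos.mpr Real.two_pi_pos
  have hlim := (Complex.continuous_re.tendsto _).comp (ha.tendsto_integral_charSum_pow h0)
  rw [Complex.ofReal_re] at hlim
  set L : ℝ := √(2 * Real.pi) ^ Fintype.card ι / √(secondMoment Y).det with hL
  have hLpos : 0 < L := div_pos (by positivity) (Real.sqrt_pos.mpr hdet)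
  refine (Asymptotics.isEquivalent_iff_tendsto_one ?_).mpr ?_
  · filter_upwards [(eventually_gt_atTop 0).filter_mono inf_le_left] with t ht
    have ht' : (0 : ℝ) < t := by exact_mod_cast ht
    have := Real.pi_pos
    exact (div_pos (pow_pos hN _) (Real.sqrt_pos.mpr (by positivity))).ne'
  have h1 := (hlim.mono_left (inf_le_left (b := 𝓟 T))).div_const L
  rw [div_self hLpos.ne'] at h1
  refine h1.congr' ?_
  filter_upwards [(eventually_gt_atTop 0).filter_mono inf_le_left,
    mem_inf_of_right (mem_principal_self T)] with t ht htT
  have ht' : (0 : ℝ) < t := by exact_mod_cast ht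
  have hs : √((2 * Real.pi * t) ^ Fintype.card ι * (secondMoment Y).det) =
      √(2 * Real.pi) ^ Fintype.card ι * √(t : ℝ) ^ Fintype.card ι * √(secondMoment Y).det := by
    have hsp : ∀ a : ℝ, 0 ≤ a → √(a ^ Fintype.card ι) = √a ^ Fintype.card ι := fun a ha => by
      rw [Real.sqrt_eq_iff_mul_self_eq (by positivity) (by positivity), ← mul_pow,
        Real.mul_self_sqrt ha]
    rw [Real.sqrt_mul (by positivity), mul_pow, Real.sqrt_mul (by positivity),
      hsp _ Real.two_pi_pos.le, hsp _ ht'.le]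
  have h2 : (2 * Real.pi) ^ Fintype.card ι =
      √(2 * Real.pi) ^ Fintype.card ι * √(2 * Real.pi) ^ Fintype.card ι := by
    rw [← mul_pow, Real.mul_self_sqrt Real.two_pi_pos.le]
  simp only [Function.comp_apply, Pi.div_apply]
  rw [integral_charSum_pow t (hT t htT), hs, Complex.re_ofReal_mul]
  have h3 : ((2 * Real.pi : ℂ) ^ Fintype.card ι *
      (Nat.card {w : Fin t → Ω // ∀ i, ∑ j, Y (w j) i = 0}) / (Fintype.card Ω : ℂ) ^ t).re =
      (2 * Real.pi) ^ Fintype.card ι *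
      (Nat.card {w : Fin t → Ω // ∀ i, ∑ j, Y (w j) i = 0}) / (Fintype.card Ω : ℝ) ^ t := by
    rw [← Complex.ofReal_re ((2 * Real.pi) ^ Fintype.card ι *
      (Nat.card {w : Fin t → Ω // ∀ i, ∑ j, Y (w j) i = 0}) / (Fintype.card Ω : ℝ) ^ t)]
    push_cast
    rfl
  rw [h3, h2, hL]
  have := (Real.sqrt_pos.mpr hdet).ne'
  field_simp

end LocalLimit

/-! ### Weights determined by their sums over `k`-sets -/

section Aperiodic

variable {V A : Type*} [DecidableEq V] [AddCommGroup A]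

theorem sum_powerset_insert_eq_singleton {W : Finset V → A} {i : V} {Q : Finset V} (hi : i ∉ Q)
    (hW : ∀ T, 2 ≤ T.card → W T = 0) : ∑ T ∈ Q.powerset, W (insert i T) = W {i} := by
  rw [Finset.sum_eq_single ∅]
  · rfl
  · intro T hT hT0
    refine hW _ ?_
    rw [Finset.card_insert_of_notMem fun h => hi (Finset.mem_powerset.mp hT h)]
    have := Finset.card_pos.mpr (Finset.nonempty_iff_ne_empty.mpr hT0)
    omega
  · simp

theorem sum_powerset_insert_insert {W : Finset V → A} {i p : V} {R : Finset V} (hi : i ∉ R)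
    (hp : p ∉ R) (hip : i ≠ p) (hW : ∀ T, 3 ≤ T.card → W T = 0) :
    ∑ T ∈ (insert p R).powerset, W (insert i T) =
      ∑ T ∈ R.powerset, W (insert i T) + W {i, p} := by
  rw [Finset.sum_powerset_insert hp]
  congr 1
  rw [Finset.sum_eq_single ∅]
  · rfl
  · intro T hT hT0
    refine hW _ ?_
    have hT' := Finset.mem_powerset.mp hT
    rw [Finset.card_insert_of_notMem, Finset.card_insert_of_notMem fun h => hp (hT' h)]
    · have := Finset.card_pos.mpr (Finset.nonempty_iff_ne_empty.mpr hT0)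
      omega
    · rw [Finset.mem_insert]
      rintro (h | h)
      exacts [hip h, hi (hT' h)]
  · simp

theorem exists_card_eq_disjoint [Fintype V] {k m : ℕ} (F : Finset V) (hF : F.card ≤ m)
    (hV : k + m ≤ Fintype.card V) : ∃ R : Finset V, R.card = k ∧ ∀ x ∈ F, x ∉ R := by
  obtain ⟨R, hR, hRc⟩ := Finset.exists_subset_card_eq (s := Fᶜ) (n := k)
    (by rw [Finset.card_compl]; omega)
  exact ⟨R, hRc, fun x hx hxR => Finset.mem_compl.mp (hR hxR) hx⟩

/-- A weight on sets of size at most two which vanishes on the sets containing `h` and on one pair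
is determined by its sums over the subsets of the `k`-sets. -/
theorem eq_zero_of_sum_powerset_const [Fintype V] {k : ℕ} (hk : 2 ≤ k) (hV : k + 2 ≤ Fintype.card V)
    {W : Finset V → A} {h : V} {e₀ : Finset V} (he₀ : e₀.card = 2) (hh : ∀ T, h ∈ T → W T = 0)
    (hW3 : ∀ T, 3 ≤ T.card → W T = 0) (hWe₀ : W e₀ = 0) (hhe₀ : h ∉ e₀)
    (hconst : ∀ S S' : Finset V, S.card = k → S'.card = k →
      ∑ T ∈ S.powerset, W T = ∑ T ∈ S'.powerset, W T)
    {T : Finset V} (hT : T.Nonempty) : W T = 0 := by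
  -- Exchange of one point of a `k`-set. Only addition and subtraction are used, so the argument
  -- survives the torsion of `ℝ/2πℤ`, where it is applied.
  have hfirst : ∀ Q : Finset V, Q.card = k - 1 → ∀ i j, i ∉ Q → j ∉ Q →
      ∑ T ∈ Q.powerset, W (insert i T) = ∑ T ∈ Q.powerset, W (insert j T) := by
    intro Q hQ i j hi hj
    have := hconst (insert i Q) (insert j Q)
      (by rw [Finset.card_insert_of_notMem hi]; omega)
      (by rw [Finset.card_insert_of_notMem hj]; omega)
    rw [Finset.sum_powerset_insert hi, Finset.sum_powerset_insert hj] at this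
    exact add_left_cancel this
  have hsecond : ∀ i p q : V, i ≠ h → p ≠ h → q ≠ h → i ≠ p → i ≠ q → W {i, p} = W {i, q} := by
    intro i p q hih hph hqh hip hiq
    rcases eq_or_ne p q with rfl | hpq
    · rfl
    -- Exchange `i` with `h` over `R ∪ {p}` and over `R ∪ {q}` and compare: the pairs through `h`
    -- weigh nothing, which isolates `W {i, p} = W {i, q}`. Finding `R` off four points uses `k + 2
    -- ≤ |V|`.
    obtain ⟨R, hRc, hR⟩ := exists_card_eq_disjoint (k := k - 2) (m := 4) {i, h, p, q}
      Finset.card_le_four (by omega)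
    simp only [Finset.mem_insert, Finset.mem_singleton, forall_eq_or_imp, forall_eq] at hR
    obtain ⟨hRi, hRh, hRp, hRq⟩ := hR
    have h1 := hfirst (insert p R) (by rw [Finset.card_insert_of_notMem hRp]; omega) i h
      (by simp [hip, hRi]) (by simp [hph.symm, hRh])
    have h2 := hfirst (insert q R) (by rw [Finset.card_insert_of_notMem hRq]; omega) i h
      (by simp [hiq, hRi]) (by simp [hqh.symm, hRh])
    rw [sum_powerset_insert_insert hRi hRp hip hW3, sum_powerset_insert_insert hRh hRp hph.symm hW3,
      hh {h, p} (by simp), add_zero] at h1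
    rw [sum_powerset_insert_insert hRi hRq hiq hW3, sum_powerset_insert_insert hRh hRq hqh.symm hW3,
      hh {h, q} (by simp), add_zero] at h2
    exact add_left_cancel (h1.trans h2.symm)
  obtain ⟨x, y, hxy, rfl⟩ := Finset.card_eq_two.mp he₀
  simp only [Finset.mem_insert, Finset.mem_singleton, not_or] at hhe₀
  have hpair : ∀ i p : V, i ≠ p → W {i, p} = 0 := by
    intro i p hip
    by_cases hi : i = h
    · exact hh _ (by simp [hi])
    by_cases hp : p = h
    · exact hh _ (by simp [hp])
    have hx : ∀ q, q ≠ h → x ≠ q → W {x, q} = 0 := fun q hq hxq => by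
      rw [hsecond x q y (Ne.symm hhe₀.1) hq (Ne.symm hhe₀.2) hxq hxy, hWe₀]
    by_cases hix : i = x
    · subst hix
      exact hx p hp hip
    · rw [hsecond i p x hi hp (Ne.symm hhe₀.1) hip hix, Finset.pair_comm]
      exact hx i hi (Ne.symm hix)
  have hW2 : ∀ T, 2 ≤ T.card → W T = 0 := by
    intro T hT
    rcases hT.eq_or_lt with hT | hT
    · obtain ⟨i, p, hip, rfl⟩ := Finset.card_eq_two.mp hT.symm
      exact hpair i p hip
    · exact hW3 T hT
  by_cases hT2 : 2 ≤ T.card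
  · exact hW2 T hT2
  · have := hT.card_pos
    obtain ⟨i, rfl⟩ := Finset.card_eq_one.mp (show T.card = 1 by omega)
    obtain ⟨Q, hQc, hQ⟩ := exists_card_eq_disjoint (k := k - 1) (m := 2) {i, h}
      Finset.card_le_two (by omega)
    simp only [Finset.mem_insert, Finset.mem_singleton, forall_eq_or_imp, forall_eq] at hQ
    have h1 := hfirst Q hQc i h hQ.1 hQ.2
    rw [sum_powerset_insert_eq_singleton hQ.1 hW2, sum_powerset_insert_eq_singleton hQ.2 hW2,
      hh {h} (by simp)] at h1
    exact h1

end Aperiodic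

/-- The subsets of `V` of size `k`. -/
abbrev Block (V : Type*) (k : ℕ) := {S : Finset V // S.card = k}

/-! ### The coordinates of the walk and their aperiodicity -/

section Coordinates

variable {V : Type*}

theorem card_block [Fintype V] (k : ℕ) : Fintype.card (Block V k) = (Fintype.card V).choose k :=
  Fintype.card_finset_len k

variable [DecidableEq V]

theorem erase_injective_of_card_two (h : V) {e f : Finset V} (he : e.card = 2) (hf : f.card = 2)
    (hef : e.erase h = f.erase h) : e = f := by
  have h1 := Finset.card_erase_add_one (s := e) (a := h)
  have h2 := Finset.card_erase_add_one (s := f) (a := h)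
  by_cases hhe : h ∈ e <;> by_cases hhf : h ∈ f
  · rw [← Finset.insert_erase hhe, hef, Finset.insert_erase hhf]
  · have := h1 hhe
    rw [hef, Finset.erase_eq_of_notMem hhf] at this
    omega
  · have := h2 hhf
    rw [← hef, Finset.erase_eq_of_notMem hhe] at this
    omega
  · rwa [Finset.erase_eq_of_notMem hhe, Finset.erase_eq_of_notMem hhf] at hef

variable [Fintype V]

theorem card_block_superset {k : ℕ} (T : Finset V) (hT : T.card ≤ k) :
    (Finset.univ.filter fun S : Block V k => T ⊆ S.1).card =
      (Fintype.card V - T.card).choose (k - T.card) := by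
  rw [← Finset.card_compl, ← Finset.card_powersetCard]
  refine Finset.card_bij' (fun S _ => S.1 \ T)
    (fun R hR => ⟨R ∪ T, ?_⟩) ?_ ?_ ?_ ?_
  · obtain ⟨h1, h2⟩ := Finset.mem_powersetCard.mp hR
    rw [Finset.card_union_of_disjoint, h2, Nat.sub_add_cancel hT]
    exact Finset.disjoint_left.mpr fun x hx => Finset.mem_compl.mp (h1 hx)
  · intro S hS
    have hS' : T ⊆ S.1 := (Finset.mem_filter.mp hS).2
    rw [Finset.mem_powersetCard, Finset.card_sdiff_of_subset hS', S.2]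
    exact ⟨fun x hx => Finset.mem_compl.mpr (Finset.mem_sdiff.mp hx).2, rfl⟩
  · intro R hR
    simp
  · intro S hS
    have hS' : T ⊆ S.1 := (Finset.mem_filter.mp hS).2
    exact Subtype.ext (Finset.sdiff_union_of_subset hS')
  · intro R hR
    obtain ⟨h1, h2⟩ := Finset.mem_powersetCard.mp hR
    refine Finset.union_sdiff_cancel_right ?_
    exact Finset.disjoint_left.mpr fun x hx => Finset.mem_compl.mp (h1 hx)

/-- The proportion of the `k`-sets that contain a given set. -/
theorem sum_block_superset {k : ℕ} (hk : k ≤ Fintype.card V) (T : Finset V) :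
    (∑ S : Block V k, if T ⊆ S.1 then (1 : ℝ) else 0) / Fintype.card (Block V k) =
      (k.choose T.card : ℝ) / (Fintype.card V).choose T.card := by
  rw [← Finset.sum_filter, Finset.sum_const, nsmul_one, card_block]
  have h1 : ((Fintype.card V).choose k : ℝ) ≠ 0 := by exact_mod_cast (Nat.choose_pos hk).ne'
  have h2 : ((Fintype.card V).choose T.card : ℝ) ≠ 0 := by
    exact_mod_cast (Nat.choose_pos T.card_le_univ).ne'
  rcases le_or_gt T.card k with hT | hT
  · rw [card_block_superset T hT, div_eq_div_iff h1 h2]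
    have := Nat.choose_mul (n := Fintype.card V) hT
    norm_cast
    linarith
  · rw [Nat.choose_eq_zero_of_lt hT, Finset.filter_eq_empty_iff.mpr]
    · simp
    · intro S _ hS
      have := Finset.card_le_card hS
      have := S.2
      omega

/-- The centred indicators of the events `e \ {h} ⊆ S`, for the pairs `e` other than `e₀`. -/
noncomputable def pairVector (k : ℕ) (h : V) (e₀ : Block V 2) (S : Block V k)
    (e : {e : Block V 2 // e ≠ e₀}) : ℝ :=
  (if e.1.1.erase h ⊆ S.1 then 1 else 0) -
    (k.choose (e.1.1.erase h).card : ℝ) / (Fintype.card V).choose (e.1.1.erase h).card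

theorem sum_pairVector {k : ℕ} (hk : k ≤ Fintype.card V) (h : V) (e₀ : Block V 2)
    (e : {e : Block V 2 // e ≠ e₀}) : ∑ S : Block V k, pairVector k h e₀ S e = 0 := by
  have hN : (Fintype.card (Block V k) : ℝ) ≠ 0 := by
    rw [card_block]
    exact_mod_cast (Nat.choose_pos hk).ne'
  have := sum_block_superset hk (e.1.1.erase h)
  rw [div_eq_iff hN] at this
  simp only [pairVector, Finset.sum_sub_distrib, this, Finset.sum_const, Finset.card_univ,
    nsmul_eq_mul]
  ring

theorem isAperiodic_pairVector {k : ℕ} (hk : 2 ≤ k) (hV : k + 2 ≤ Fintype.card V) {h : V}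
    {e₀ : Block V 2} (hh : h ∉ e₀.1) : IsAperiodic (pairVector k h e₀) := by
  intro θ hθ
  let τ : Block V 2 → AddCircle (2 * Real.pi) := fun e =>
    if he : e ≠ e₀ then ((θ ⟨e, he⟩ : ℝ) : AddCircle (2 * Real.pi)) else 0
  -- Transport the angles to the sets `e \ {h}`, with angle 0 at `e₀`. The sum of `W` over the
  -- subsets of a block is then its uncentred phase modulo `2π`.
  let W : Finset V → AddCircle (2 * Real.pi) := fun T =>
    ∑ e : Block V 2, if e.1.erase h = T then τ e else 0
  have hWe : ∀ e : Block V 2, W (e.1.erase h) = τ e := by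
    intro e
    simp only [W]
    rw [Finset.sum_eq_single e, if_pos rfl]
    · intro f _ hf
      rw [if_neg]
      exact fun hc => hf (Subtype.ext (erase_injective_of_card_two h f.2 e.2 hc))
    · simp
  have hW0 : ∀ T : Finset V, (∀ e : Block V 2, e.1.erase h ≠ T) → W T = 0 := fun T hT =>
    Finset.sum_eq_zero fun e _ => if_neg (hT e)
  have hsum : ∀ S : Block V k, ∑ T ∈ S.1.powerset, W T =
      ((∑ e, θ e * (if e.1.1.erase h ⊆ S.1 then 1 else 0) : ℝ) : AddCircle (2 * Real.pi)) := by
    intro S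
    simp only [W]
    rw [Finset.sum_comm]
    simp only [Finset.sum_ite_eq, Finset.mem_powerset]
    rw [← Fintype.sum_subtype_add_sum_subtype (fun e : Block V 2 => e ≠ e₀),
      Finset.sum_eq_zero (s := (Finset.univ : Finset {e : Block V 2 // ¬ e ≠ e₀})), add_zero]
    · refine Eq.trans ?_ (map_sum (QuotientAddGroup.mk' (AddSubgroup.zmultiples (2 * Real.pi))) _ _).symm
      refine Finset.sum_congr rfl fun e _ => ?_
      simp only [τ, dif_pos e.2, QuotientAddGroup.mk'_apply]
      split_ifs <;> simp
    · intro e _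
      simp only [τ, dif_neg e.2, ite_self]
  intro e
  have hWT := eq_zero_of_sum_powerset_const (W := W) (h := h) (e₀ := e₀.1) hk hV e₀.2
    (fun T hT => hW0 T fun e he => by simp [← he] at hT)
    (fun T hT => hW0 T fun e he => by
      have h1 := Finset.card_erase_le (s := e.1) (a := h)
      rw [he, e.2] at h1
      omega)
    (by
      have := hWe e₀
      rw [Finset.erase_eq_of_notMem hh] at this
      simpa [τ] using this) hh
    (fun S S' hS hS' => by
      rw [hsum ⟨S, hS⟩, hsum ⟨S', hS'⟩, ← sub_eq_zero, ← AddCircle.coe_sub,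
        AddCircle.coe_eq_zero_iff]
      obtain ⟨n, hn⟩ := hθ ⟨S, hS⟩ ⟨S', hS'⟩
      refine ⟨n, ?_⟩
      rw [zsmul_eq_mul, ← hn]
      simp only [dotProduct, pairVector, mul_sub, Finset.sum_sub_distrib]
      ring)
    (T := e.1.1.erase h)
    (Finset.card_pos.mp (by have := Finset.pred_card_le_card_erase (s := e.1.1) (a := h)
                            rw [e.1.2] at this; omega))
  rw [hWe] at hWT
  simp only [τ, dif_pos e.2] at hWT
  obtain ⟨n, hn⟩ := (AddCircle.coe_eq_zero_iff _).mp hWT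
  exact ⟨n, by rw [← hn, zsmul_eq_mul]⟩

end Coordinates

/-! ### Pair replication numbers from the reduced coordinates -/

section Replication

variable {V : Type*} [DecidableEq V] {k t : ℕ}

/-- The number of blocks of the word `w` that contain the set `T`. -/
def blocksContaining (w : Fin t → Block V k) (T : Finset V) : ℝ :=
  ∑ j, if T ⊆ (w j).1 then 1 else 0

variable [Fintype V]

theorem sum_blocksContaining_singleton (w : Fin t → Block V k) :
    ∑ i, blocksContaining w {i} = t * k := by
  simp only [blocksContaining, Finset.singleton_subset_iff]
  rw [Finset.sum_comm]
  simp [(w _).2]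

theorem sum_blocksContaining_pair (w : Fin t → Block V k) (i : V) :
    ∑ i', blocksContaining w {i, i'} = k * blocksContaining w {i} := by
  simp only [blocksContaining, Finset.mul_sum]
  rw [Finset.sum_comm]
  refine Finset.sum_congr rfl fun j _ => ?_
  simp only [Finset.insert_subset_iff, Finset.singleton_subset_iff]
  by_cases hi : i ∈ (w j).1 <;> simp [hi, (w j).2]

theorem sum_pairVector_word (w : Fin t → Block V k) (h : V) (e₀ : Block V 2)
    (e : {e : Block V 2 // e ≠ e₀}) : ∑ j, pairVector k h e₀ (w j) e =
      blocksContaining w (e.1.1.erase h) -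
        t * ((k.choose (e.1.1.erase h).card : ℝ) /
          (Fintype.card V).choose (e.1.1.erase h).card) := by
  simp [pairVector, blocksContaining, Finset.sum_sub_distrib]

theorem choose_two_div_choose_two (a b : ℕ) : (a.choose 2 : ℝ) / b.choose 2 =
    (a : ℝ) * (a - 1) / (b * (b - 1)) := by
  rw [Nat.cast_choose_two, Nat.cast_choose_two, div_div_div_cancel_right₀ two_ne_zero]

/-- The coordinates `e \ {h}` with `e ≠ e₀` determine all the pair replication numbers. -/
theorem forall_sum_pairVector_eq_zero_iff (hk : 2 ≤ k) (hV : k + 2 ≤ Fintype.card V) {h : V}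
    {e₀ : Block V 2} (hh : h ∉ e₀.1) (w : Fin t → Block V k) :
    (∀ e, ∑ j, pairVector k h e₀ (w j) e = 0) ↔
      ∀ i i', i ≠ i' → blocksContaining w {i, i'} =
        t * ((k : ℝ) * (k - 1) / (Fintype.card V * ((Fintype.card V : ℝ) - 1))) := by
  set v := (Fintype.card V : ℝ) with hv
  have hk1 : (2 : ℝ) ≤ k := by exact_mod_cast hk
  have hv4 : (4 : ℝ) ≤ v := by
    rw [hv]
    exact_mod_cast (by omega : 4 ≤ Fintype.card V)
  set lam : ℝ := t * ((k : ℝ) * (k - 1) / (v * (v - 1))) with hlam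
  have hlamr : (v - 1) * lam = (k - 1) * (t * (k / v)) := by
    rw [hlam]
    have : v - 1 ≠ 0 := by linarith
    field_simp
  simp only [sum_pairVector_word, sub_eq_zero]
  have hcard : ∀ i : V, ((Finset.univ.erase i).card : ℝ) = v - 1 := fun i => by
    rw [Finset.card_erase_of_mem (Finset.mem_univ i), Finset.card_univ, Nat.cast_pred (by omega)]
  have hpairsum : ∀ i, ∑ i' ∈ Finset.univ.erase i, blocksContaining w {i, i'} =
      (k - 1) * blocksContaining w {i} := by
    intro i
    have h1 := sum_blocksContaining_pair w i
    rw [← Finset.add_sum_erase _ _ (Finset.mem_univ i), Finset.pair_eq_singleton] at h1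
    linarith
  constructor
  · intro hX
    have hsingle : ∀ i, i ≠ h → blocksContaining w {i} = t * (k / v) := by
      intro i hi
      have h1 := hX ⟨⟨{h, i}, Finset.card_pair hi.symm⟩, fun hc => hh (by rw [← hc]; simp)⟩
      simpa [Finset.erase_insert_eq_erase, Finset.erase_eq_of_notMem, hi.symm] using h1
    have hpair : ∀ i p, i ≠ p → i ≠ h → p ≠ h → {i, p} ≠ e₀.1 →
        blocksContaining w {i, p} = lam := by
      intro i p hip hi hp hne
      have h1 := hX ⟨⟨{i, p}, Finset.card_pair hip⟩, fun hc => hne (by rw [← hc])⟩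
      rw [Finset.erase_eq_of_notMem (by simp [hi.symm, hp.symm]), Finset.card_pair hip,
        choose_two_div_choose_two] at h1
      exact h1
    have hall : ∀ i, blocksContaining w {i} = t * (k / v) := by
      intro i
      -- The replication number of `h` is recovered from the total `t * k`.
      by_cases hi : i = h
      · subst hi
        have h1 := sum_blocksContaining_singleton w
        rw [← Finset.add_sum_erase _ _ (Finset.mem_univ i),
          Finset.sum_congr rfl fun p hp => hsingle p (Finset.ne_of_mem_erase hp),
          Finset.sum_const, nsmul_eq_mul, hcard] at h1
        field_simp at h1 ⊢
        linarith
      · exact hsingle i hi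
    set δ : V → V → ℝ := fun i p => blocksContaining w {i, p} - lam with hδ
    have hsymm : ∀ i p, δ i p = δ p i := fun i p => by simp only [hδ, Finset.pair_comm]
    have hrow : ∀ i, ∑ p ∈ Finset.univ.erase i, δ i p = 0 := by
      intro i
      simp only [hδ, Finset.sum_sub_distrib, hpairsum, hall, Finset.sum_const, nsmul_eq_mul,
        hcard, hlamr, sub_self]
    have hδ0 : ∀ i p, i ≠ p → i ≠ h → p ≠ h → {i, p} ≠ e₀.1 → δ i p = 0 :=
      fun i p hip hi hp hne => sub_eq_zero.mpr (hpair i p hip hi hp hne)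
    obtain ⟨x, y, hxy, hexy⟩ := Finset.card_eq_two.mp e₀.2
    have hxh : x ≠ h := by rintro rfl; simp [hexy] at hh
    have hyh : y ≠ h := by rintro rfl; simp [hexy] at hh
    rw [hexy] at hδ0
    -- The deviations have zero row sums. A row outside `{h, x, y}` has the single possible nonzero
    -- entry `δ i h`. The rows of `h`, `x`, `y` then say that the three deviations on this triangle
    -- have vanishing pairwise sums, so all three vanish.
    have hout : ∀ i, i ≠ h → i ≠ x → i ≠ y → δ i h = 0 := by
      intro i hi hix hiy
      rw [← hrow i, Finset.sum_eq_single h]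
      · intro p hp hph
        refine hδ0 i p (Finset.ne_of_mem_erase hp).symm hi hph fun hc => ?_
        have : i ∈ ({x, y} : Finset V) := by rw [← hc]; simp
        simp [hix, hiy] at this
      · simp [hi.symm]
    have hend : ∀ a b, a ≠ b → a ≠ h → b ≠ h → ({a, b} : Finset V) = {x, y} →
        δ a h + δ a b = 0 := by
      intro a b hab ha hb habxy
      rw [← hrow a, Finset.sum_eq_add h b hb.symm]
      · intro p hp hph
        refine hδ0 a p (Finset.ne_of_mem_erase hp).symm ha hph.1 fun hc => ?_
        have : p ∈ ({a, b} : Finset V) := by rw [habxy, ← hc]; simp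
        simp [hph.2, Finset.ne_of_mem_erase hp] at this
      · simp [ha.symm]
      · simp [hab.symm]
    have hx := hend x y hxy hxh hyh rfl
    have hy := hend y x hxy.symm hyh hxh (Finset.pair_comm _ _)
    have hhub : δ h x + δ h y = 0 := by
      rw [← hrow h, Finset.sum_eq_add x y hxy]
      · intro p hp hpxy
        rw [hsymm]
        exact hout p (Finset.ne_of_mem_erase hp) hpxy.1 hpxy.2
      · simp [hxh]
      · simp [hyh]
    rw [hsymm h x, hsymm h y] at hhub
    rw [hsymm y x] at hy
    have hxy0 : δ x y = 0 := by linarith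
    have hxh0 : δ x h = 0 := by linarith
    have hyh0 : δ y h = 0 := by linarith
    have hh0 : ∀ i, i ≠ h → δ i h = 0 := by
      intro i hi
      by_cases hix : i = x
      · rw [hix, hxh0]
      by_cases hiy : i = y
      · rw [hiy, hyh0]
      exact hout i hi hix hiy
    intro i p hip
    rw [← sub_eq_zero]
    change δ i p = 0
    by_cases hi : i = h
    · rw [hi, hsymm, hh0 p (by rw [← hi]; exact hip.symm)]
    by_cases hp : p = h
    · rw [hp, hh0 i hi]
    by_cases hc : ({i, p} : Finset V) = {x, y}
    · have hix : i ∈ ({x, y} : Finset V) := by rw [← hc]; simp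
      have hpx : p ∈ ({x, y} : Finset V) := by rw [← hc]; simp
      simp only [Finset.mem_insert, Finset.mem_singleton] at hix hpx
      rcases hix with rfl | rfl <;> rcases hpx with rfl | rfl
      · exact absurd rfl hip
      · exact hxy0
      · rw [hsymm, hxy0]
      · exact absurd rfl hip
    · exact hδ0 i p hip hi hp hc
  · intro hl e
    have hsingle : ∀ i, blocksContaining w {i} = t * (k / v) := by
      intro i
      have h1 := hpairsum i
      rw [Finset.sum_congr rfl fun p hp => hl i p (Finset.ne_of_mem_erase hp).symm,
        Finset.sum_const, nsmul_eq_mul, hcard, hlamr] at h1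
      exact (mul_left_cancel₀ (by linarith) h1).symm
    obtain ⟨a, b, hab, he⟩ := Finset.card_eq_two.mp e.1.2
    by_cases hhe : h ∈ e.1.1
    · have hc : (e.1.1.erase h).card = 1 := by
        rw [Finset.card_erase_of_mem hhe, e.1.2]
      obtain ⟨i, hi⟩ := Finset.card_eq_one.mp hc
      rw [hi, hsingle]
      simp [hv]
    · rw [Finset.erase_eq_of_notMem hhe, e.1.2, choose_two_div_choose_two, he]
      exact hl a b hab

end Replication

/-! ### Designs as words of blocks -/

section Incidence

variable {v k t : ℕ}

/-- The incidence matrix whose columns are the given blocks. -/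
def incidenceMatrix (w : Fin t → Block (Fin v) k) : Matrix (Fin v) (Fin t) ℕ :=
  fun i j => if i ∈ (w j).1 then 1 else 0

theorem incidenceMatrix_injective :
    Function.Injective (incidenceMatrix : (Fin t → Block (Fin v) k) → _) := by
  intro w w' hw
  funext j
  refine Subtype.ext (Finset.ext fun i => ?_)
  have := congrFun (congrFun hw i) j
  simp only [incidenceMatrix] at this
  by_cases h1 : i ∈ (w j).1 <;> by_cases h2 : i ∈ (w' j).1 <;> simp_all

theorem columnOnes_incidenceMatrix (w : Fin t → Block (Fin v) k) (j : Fin t) :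
    columnOnes (incidenceMatrix w) j = k := by
  simp [columnOnes, incidenceMatrix, (w j).2]

theorem dotProduct_incidenceMatrix (w : Fin t → Block (Fin v) k) (i i' : Fin v) :
    ((dotProduct (incidenceMatrix w i) (incidenceMatrix w i') : ℕ) : ℝ) =
      blocksContaining w {i, i'} := by
  simp only [dotProduct, incidenceMatrix, blocksContaining]
  push_cast
  refine Finset.sum_congr rfl fun j _ => ?_
  simp only [Finset.insert_subset_iff, Finset.singleton_subset_iff]
  by_cases h1 : i ∈ (w j).1 <;> by_cases h2 : i' ∈ (w j).1 <;> simp [h1, h2]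

/-- Double counting gives `(k - 1) r = (v - 1) l` at each point and `t * k` in total, which forces
the index `l`. Conversely `0 < t` makes this index positive. -/
theorem incidenceMatrix_mem_bibdMatrices_iff (hk : 2 ≤ k) (hv : k + 2 ≤ v) (ht : 0 < t)
    (w : Fin t → Block (Fin v) k) : incidenceMatrix w ∈ bibdMatrices v k t ↔
      ∀ i i', i ≠ i' → blocksContaining w {i, i'} =
        t * ((k : ℝ) * (k - 1) / (v * ((v : ℝ) - 1))) := by
  have hk2 : (2 : ℝ) ≤ k := by exact_mod_cast hk
  have hv4 : (4 : ℝ) ≤ v := by exact_mod_cast (by omega : 4 ≤ v)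
  have ht0 : (0 : ℝ) < t := by exact_mod_cast ht
  constructor
  · rintro ⟨⟨-, -, l, -, -, -, hl⟩, -⟩ i i' hii'
    have hl' : ∀ i i', i ≠ i' → blocksContaining w {i, i'} = l := fun i i' h => by
      rw [← dotProduct_incidenceMatrix, hl i i' h]
    have hcard : ∀ i : Fin v, ((Finset.univ.erase i).card : ℝ) = v - 1 := fun i => by
      rw [Finset.card_erase_of_mem (Finset.mem_univ i), Finset.card_univ, Fintype.card_fin,
        Nat.cast_pred (by omega)]
    have h1 : ∀ i, (k - 1) * blocksContaining w {i} = (v - 1) * l := by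
      intro i
      have h1 := sum_blocksContaining_pair w i
      rw [← Finset.add_sum_erase _ _ (Finset.mem_univ i), Finset.pair_eq_singleton,
        Finset.sum_congr rfl fun p hp => hl' i p (Finset.ne_of_mem_erase hp).symm,
        Finset.sum_const, nsmul_eq_mul, hcard] at h1
      linarith
    have h2 := congrArg (fun x => ((k : ℝ) - 1) * x) (sum_blocksContaining_singleton w)
    simp only [Finset.mul_sum, h1, Finset.sum_const, Finset.card_univ, Fintype.card_fin,
      nsmul_eq_mul] at h2
    rw [hl' i i' hii']
    have : (v : ℝ) - 1 ≠ 0 := by linarith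
    field_simp
    linarith
  · intro h
    have hdot : ∀ i i' : Fin v, i ≠ i' →
        ((dotProduct (incidenceMatrix w i) (incidenceMatrix w i') : ℕ) : ℝ) =
          t * ((k : ℝ) * (k - 1) / (v * ((v : ℝ) - 1))) := fun i i' hii' => by
      rw [dotProduct_incidenceMatrix, h i i' hii']
    have hne : (⟨0, by omega⟩ : Fin v) ≠ ⟨1, by omega⟩ := by simp
    refine ⟨⟨fun i j => ?_, k, dotProduct (incidenceMatrix w ⟨0, by omega⟩)
      (incidenceMatrix w ⟨1, by omega⟩), by omega, ?_, columnOnes_incidenceMatrix w,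
      fun i i' hii' => ?_⟩, columnOnes_incidenceMatrix w⟩
    · simp only [incidenceMatrix]
      split_ifs <;> simp
    · rw [← Nat.cast_pos (α := ℝ), hdot _ _ hne]
      have h1 : (0 : ℝ) < k - 1 := by linarith
      have h2 : (0 : ℝ) < v - 1 := by linarith
      positivity
    · rw [← Nat.cast_inj (R := ℝ), hdot _ _ hne, hdot _ _ hii']

theorem exists_incidenceMatrix_eq {A : Matrix (Fin v) (Fin t) ℕ} (hA : A ∈ bibdMatrices v k t) :
    ∃ w : Fin t → Block (Fin v) k, incidenceMatrix w = A := by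
  refine ⟨fun j => ⟨Finset.univ.filter fun i => A i j = 1, hA.2 j⟩, ?_⟩
  funext i j
  rcases hA.1.1 i j with h | h <;> simp [incidenceMatrix, h]

theorem bibdCount_eq_card (hk : 2 ≤ k) (hv : k + 2 ≤ v) (ht : 0 < t) {h : Fin v}
    {e₀ : Block (Fin v) 2} (hh : h ∉ e₀.1) :
    bibdCount v k t =
      Nat.card {w : Fin t → Block (Fin v) k // ∀ e, ∑ j, pairVector k h e₀ (w j) e = 0} := by
  have hiff : ∀ w : Fin t → Block (Fin v) k, incidenceMatrix w ∈ bibdMatrices v k t ↔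
      ∀ e, ∑ j, pairVector k h e₀ (w j) e = 0 := fun w => by
    rw [incidenceMatrix_mem_bibdMatrices_iff hk hv ht,
      forall_sum_pairVector_eq_zero_iff hk (by simpa using hv) hh, Fintype.card_fin]
  have himage : bibdMatrices v k t =
      incidenceMatrix '' {w | ∀ e, ∑ j, pairVector k h e₀ (w j) e = 0} := by
    ext A
    constructor
    · intro hA
      obtain ⟨w, rfl⟩ := exists_incidenceMatrix_eq hA
      exact ⟨w, (hiff w).mp hA, rfl⟩
    · rintro ⟨w, hw, rfl⟩
      exact (hiff w).mpr hw
  rw [bibdCount, himage, Set.ncard_image_of_injective _ incidenceMatrix_injective,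
    ← Nat.card_coe_set_eq]
  rfl

/-- A coordinate sum is a number of blocks minus `t` times a mean; the two admissibility conditions
are the integrality of this product for points and for pairs. -/
theorem exists_int_sum_pairVector (ht : t ∈ admissibleColumns v k) (h : Fin v)
    (e₀ : Block (Fin v) 2) (w : Fin t → Block (Fin v) k) (e : {e : Block (Fin v) 2 // e ≠ e₀}) :
    ∃ n : ℤ, ∑ j, pairVector k h e₀ (w j) e = n := by
  obtain ⟨⟨r, hr⟩, l, hl⟩ := ht
  have hmean : ∃ n : ℤ, (t : ℝ) * ((k.choose (e.1.1.erase h).card : ℝ) /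
      (Fintype.card (Fin v)).choose (e.1.1.erase h).card) = n := by
    rw [Fintype.card_fin]
    by_cases hhe : h ∈ e.1.1
    · rw [Finset.card_erase_of_mem hhe, e.1.2]
      refine ⟨r, ?_⟩
      have := congrArg (fun x : ℚ => (x : ℝ)) hr
      push_cast at this
      simpa using this
    · rw [Finset.erase_eq_of_notMem hhe, e.1.2, choose_two_div_choose_two]
      refine ⟨l, ?_⟩
      have := congrArg (fun x : ℚ => (x : ℝ)) hl
      push_cast at this
      exact this
  obtain ⟨n, hn⟩ := hmean
  refine ⟨(∑ j, if e.1.1.erase h ⊆ (w j).1 then 1 else 0) - n, ?_⟩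
  rw [sum_pairVector_word, hn, blocksContaining]
  push_cast
  rfl

end Incidence

/-! ### Determinant of the second moments of the pair indicators -/

section Determinant

/-- A rank-one update. The extra factor `x` avoids the exponent `card n - 1`. -/
theorem det_smul_one_add_const_mul {n : Type*} [Fintype n] [DecidableEq n] {x : ℝ} (hx : x ≠ 0)
    (y : ℝ) : (x • (1 : Matrix n n ℝ) + Matrix.of fun _ _ => y).det * x =
      x ^ Fintype.card n * (x + Fintype.card n * y) := by
  have h : x • (1 : Matrix n n ℝ) + Matrix.of (fun _ _ => y) =
      x • (1 + replicateCol Unit (fun _ : n => y / x) * replicateRow Unit fun _ : n => (1 : ℝ)) := by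
    ext i j
    simp [Matrix.mul_apply, mul_add, mul_div_cancel₀ _ hx]
  rw [h, det_smul, det_one_add_replicateCol_mul_replicateRow]
  simp only [dotProduct, one_mul, Finset.sum_const, Finset.card_univ, nsmul_eq_mul]
  field_simp

theorem secondMoment_eq_smul {n Ω : Type*} [Fintype Ω] (Y : Ω → n → ℝ) :
    secondMoment Y = (Fintype.card Ω : ℝ)⁻¹ • ((Matrix.of Y)ᵀ * Matrix.of Y) := by
  ext i j
  simp [secondMoment, Matrix.mul_apply, div_eq_inv_mul]

theorem secondMoment_mulVec {m n Ω : Type*} [Fintype n] [Fintype Ω]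
    (M : Matrix m n ℝ) (Z : Ω → n → ℝ) :
    secondMoment (fun ω => M *ᵥ Z ω) = M * secondMoment Z * Mᵀ := by
  have hM : Matrix.of (fun ω => M *ᵥ Z ω) = Matrix.of Z * Mᵀ := by
    ext ω i
    simp [Matrix.mul_apply, mulVec, dotProduct, mul_comm]
  rw [secondMoment_eq_smul, secondMoment_eq_smul, hM, transpose_mul, transpose_transpose, Matrix.mul_smul, Matrix.smul_mul]
  simp only [Matrix.mul_assoc]

variable {V : Type*} [Fintype V] [DecidableEq V]

/-- The incidence matrix of points and pairs. -/
def pairIncidence (V : Type*) [DecidableEq V] : Matrix V (Block V 2) ℝ :=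
  Matrix.of fun i e => if i ∈ e.1 then 1 else 0

/-- The indicators of the events `e ⊆ S`. -/
def pairIndicator (k : ℕ) (S : Block V k) (e : Block V 2) : ℝ := if e.1 ⊆ S.1 then 1 else 0

theorem pairIncidence_mul_transpose (hV : 2 ≤ Fintype.card V) :
    pairIncidence V * (pairIncidence V)ᵀ =
      ((Fintype.card V : ℝ) - 2) • (1 : Matrix V V ℝ) + Matrix.of fun _ _ => 1 := by
  ext i i'
  have h : (pairIncidence V * (pairIncidence V)ᵀ) i i' =
      ((Finset.univ.filter fun e : Block V 2 => ({i, i'} : Finset V) ⊆ e.1).card : ℝ) := by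
    rw [Finset.card_filter]
    push_cast
    simp only [Matrix.mul_apply, transpose_apply, pairIncidence, Matrix.of_apply]
    refine Finset.sum_congr rfl fun e _ => ?_
    simp only [Finset.insert_subset_iff, Finset.singleton_subset_iff]
    by_cases h1 : i ∈ e.1 <;> by_cases h2 : i' ∈ e.1 <;> simp [h1, h2]
  rw [h, card_block_superset _ Finset.card_le_two]
  by_cases hi : i = i'
  · subst hi
    simp [Nat.cast_sub (by omega : 1 ≤ Fintype.card V)]
    ring
  · simp [Finset.card_pair hi, hi]

theorem sum_sum_mem (f : Block V 2 → ℝ) :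
    ∑ i, ∑ e : Block V 2, (if i ∈ e.1 then f e else 0) = 2 * ∑ e, f e := by
  rw [Finset.sum_comm, Finset.mul_sum]
  refine Finset.sum_congr rfl fun e _ => ?_
  simp [e.2]

theorem sum_mem_eq_sum_pair (i : V) (f : Finset V → ℝ) :
    ∑ e : Block V 2, (if i ∈ e.1 then f e.1 else 0) = ∑ p ∈ Finset.univ.erase i, f {i, p} := by
  rw [← Finset.sum_filter]
  symm
  refine Finset.sum_bij
    (fun p hp => ⟨{i, p}, Finset.card_pair (Finset.ne_of_mem_erase hp).symm⟩) ?_ ?_ ?_ ?_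
  · intro p hp
    simp
  · intro p hp q hq hpq
    have h1 : p ∈ ({i, q} : Finset V) := by
      rw [← show ({i, p} : Finset V) = {i, q} from congrArg Subtype.val hpq]
      simp
    simpa [Finset.ne_of_mem_erase hp] using h1
  · intro e he
    have hie : i ∈ e.1 := (Finset.mem_filter.mp he).2
    obtain ⟨p, hp⟩ := Finset.card_eq_one.mp
      (show (e.1.erase i).card = 1 by rw [Finset.card_erase_of_mem hie, e.2])
    have hpe : p ∈ e.1.erase i := by rw [hp]; simp
    refine ⟨p, by simp [Finset.ne_of_mem_erase hpe], Subtype.ext ?_⟩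
    change {i, p} = e.1
    rw [← hp, Finset.insert_erase hie]
  · intro p hp
    rfl

theorem secondMoment_pairIndicator_apply {k : ℕ} (hk : k ≤ Fintype.card V) (e f : Block V 2) :
    secondMoment (pairIndicator (V := V) k) e f =
      (k.choose (e.1 ∪ f.1).card : ℝ) / (Fintype.card V).choose (e.1 ∪ f.1).card := by
  rw [← sum_block_superset hk]
  simp only [secondMoment, Matrix.of_apply, pairIndicator, Finset.union_subset_iff]
  congr 1
  refine Finset.sum_congr rfl fun S _ => ?_
  by_cases h1 : e.1 ⊆ S.1 <;> by_cases h2 : f.1 ⊆ S.1 <;> simp [h1, h2]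

/-- Entries depend only on `|e ∩ f|`, with values `q 4`, `q 3`, `q 2` at 0, 1, 2, and `|e ∩ f|` is
an entry of `Nᵀ N` for the incidence matrix `N`. Columns of `N` sum to 2, whence the `q 4 / 4`. -/
theorem secondMoment_pairIndicator {k : ℕ} (hk : k ≤ Fintype.card V) {q : ℕ → ℝ}
    (hq : ∀ j, q j = (k.choose j : ℝ) / (Fintype.card V).choose j) :
    secondMoment (pairIndicator (V := V) k) = (q 2 - 2 * q 3 + q 4) • (1 : Matrix _ _ ℝ) +
      (pairIncidence V)ᵀ * (((q 3 - q 4) • (1 : Matrix V V ℝ) + Matrix.of fun _ _ => q 4 / 4) *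
        pairIncidence V) := by
  ext e f
  rw [secondMoment_pairIndicator_apply hk, ← hq]
  have hsum : ∀ f : Block V 2, ∑ i, pairIncidence V i f = 2 := fun f => by
    simp [pairIncidence, f.2]
  have hinner : ∑ i, pairIncidence V i e * pairIncidence V i f = (e.1 ∩ f.1).card := by
    simp only [pairIncidence, Matrix.of_apply, mul_ite, mul_one, mul_zero]
    rw [Finset.card_eq_sum_ones, Nat.cast_sum, ← Finset.sum_filter, ← Finset.sum_filter]
    simp [Finset.filter_mem_eq_inter, Finset.inter_comm]
  set K : Matrix V V ℝ := (q 3 - q 4) • (1 : Matrix V V ℝ) + Matrix.of fun _ _ => q 4 / 4 with hK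
  have hprod : ((pairIncidence V)ᵀ * (K * pairIncidence V)) e f =
      (q 3 - q 4) * (e.1 ∩ f.1).card + q 4 := by
    have h1 : ∀ i, (K * pairIncidence V) i f =
        (q 3 - q 4) * pairIncidence V i f + q 4 / 2 := by
      intro i
      rw [hK, Matrix.add_mul, Matrix.smul_mul, Matrix.one_mul, Matrix.add_apply, Matrix.smul_apply,
        Matrix.mul_apply, smul_eq_mul]
      simp only [Matrix.of_apply, ← Finset.mul_sum, hsum]
      ring
    rw [Matrix.mul_apply]
    simp only [h1, transpose_apply, mul_add, Finset.sum_add_distrib, ← Finset.sum_mul, hsum]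
    rw [← hinner, Finset.mul_sum]
    congr 1
    · exact Finset.sum_congr rfl fun i _ => by ring
    · ring
  rw [Matrix.add_apply, hprod, Matrix.smul_apply, Matrix.one_apply, smul_eq_mul]
  have hcard := Finset.card_union_add_card_inter e.1 f.1
  rw [e.2, f.2] at hcard
  by_cases hef : e = f
  · subst hef
    rw [if_pos rfl, Finset.union_self, Finset.inter_self, e.2]
    push_cast
    ring
  · have hlt : (e.1 ∩ f.1).card < 2 := by
      by_contra hge
      have h1 : e.1 ∩ f.1 = e.1 :=
        Finset.eq_of_subset_of_card_le Finset.inter_subset_left (by rw [e.2]; omega)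
      have h2 : e.1 ∩ f.1 = f.1 :=
        Finset.eq_of_subset_of_card_le Finset.inter_subset_right (by rw [f.2]; omega)
      exact hef (Subtype.ext (h1.symm.trans h2))
    rw [if_neg hef]
    have h01 : (e.1 ∩ f.1).card = 0 ∨ (e.1 ∩ f.1).card = 1 := by omega
    rcases h01 with h | h
    · rw [h, show (e.1 ∪ f.1).card = 4 by omega]
      push_cast
      ring
    · rw [h, show (e.1 ∪ f.1).card = 3 by omega]
      push_cast
      ring

/-- `det (1 + AB) = det (1 + BA)` moves the computation from pairs to points, where `N Nᵀ` is a
scalar matrix plus a constant one. The eigenvalues are `μ` (constants), `κ` (sum-zero vectors on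
points) and `α` (the kernel of `N`). -/
theorem det_secondMoment_pairIndicator {k : ℕ} (hk : k ≤ Fintype.card V)
    (hV : 2 ≤ Fintype.card V) {q : ℕ → ℝ}
    (hq : ∀ j, q j = (k.choose j : ℝ) / (Fintype.card V).choose j) {α κ μ : ℝ} (hα : α ≠ 0)
    (hκ : κ ≠ 0) (hαq : α = q 2 - 2 * q 3 + q 4)
    (hκq : κ = α + (q 3 - q 4) * (Fintype.card V - 2))
    (hμq : μ = κ + Fintype.card V * (q 3 - q 4 + q 4 / 2 * (Fintype.card V - 1))) {r n : ℕ}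
    (hn : Fintype.card V = n + 1) (hr : (Fintype.card V).choose 2 = Fintype.card V + r) :
    (secondMoment (pairIndicator (V := V) k)).det = α ^ r * κ ^ n * μ := by
  set K : Matrix V V ℝ := (q 3 - q 4) • (1 : Matrix V V ℝ) + Matrix.of fun _ _ => q 4 / 4 with hK
  have hfac : secondMoment (pairIndicator (V := V) k) =
      α • (1 + (pairIncidence V)ᵀ * (α⁻¹ • (K * pairIncidence V))) := by
    rw [secondMoment_pairIndicator hk hq, smul_add, Matrix.mul_smul, smul_smul,
      mul_inv_cancel₀ hα, one_smul, hαq]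
  have hKN : 1 + α⁻¹ • (K * pairIncidence V) * (pairIncidence V)ᵀ = (κ / α) • (1 : Matrix V V ℝ) +
      Matrix.of fun _ _ => (q 3 - q 4 + q 4 / 2 * (Fintype.card V - 1)) / α := by
    rw [Matrix.smul_mul, Matrix.mul_assoc, pairIncidence_mul_transpose hV, hK]
    ext i j
    simp only [Matrix.add_mul, Matrix.mul_add, Matrix.smul_mul, Matrix.mul_smul, Matrix.one_mul,
      Matrix.mul_one, Matrix.add_apply, Matrix.smul_apply, smul_eq_mul, Matrix.of_apply,
      Matrix.mul_apply, Finset.sum_const, Finset.card_univ, nsmul_eq_mul, hκq]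
    field_simp
    ring
  have hdet := det_smul_one_add_const_mul (n := V) (div_ne_zero hκ hα)
    ((q 3 - q 4 + q 4 / 2 * (Fintype.card V - 1)) / α)
  have h2 : κ / α + Fintype.card V *
      ((q 3 - q 4 + q 4 / 2 * (Fintype.card V - 1)) / α) = μ / α := by
    rw [hμq]
    ring
  rw [h2, hn, pow_succ, mul_right_comm] at hdet
  have hdet' := mul_right_cancel₀ (div_ne_zero hκ hα) hdet
  rw [hfac, det_smul, det_one_add_mul_comm, hKN]
  rw [← hn] at hdet'
  rw [hdet', card_block, hr, hn, pow_add, pow_succ, div_pow]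
  field_simp

end Determinant

/-! ### Change of coordinates and the constant `f(v,k)` -/

section Covariance

variable {V : Type*} [Fintype V] [DecidableEq V] {k : ℕ} {h : V} {e₀ : Block V 2}

theorem sum_pairIndicator_mem (S : Block V k) (i : V) :
    ∑ e : Block V 2, (if i ∈ e.1 then pairIndicator k S e else 0) =
      if i ∈ S.1 then (k : ℝ) - 1 else 0 := by
  have h1 := sum_mem_eq_sum_pair i fun T => if T ⊆ S.1 then (1 : ℝ) else 0
  simp only [pairIndicator]
  rw [h1]
  simp only [Finset.insert_subset_iff, Finset.singleton_subset_iff]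
  by_cases hi : i ∈ S.1
  · have h2 := Finset.add_sum_erase Finset.univ (fun p => if p ∈ S.1 then (1 : ℝ) else 0)
      (Finset.mem_univ i)
    have h3 : ∑ p, (if p ∈ S.1 then (1 : ℝ) else 0) = k := by simp [S.2]
    rw [h3, if_pos hi] at h2
    simp only [hi, true_and, if_true]
    linarith
  · simp [hi]

theorem sum_pairIndicator (S : Block V k) : ∑ e, pairIndicator k S e = k.choose 2 := by
  have h1 := sum_sum_mem (pairIndicator k S)
  simp only [sum_pairIndicator_mem, Finset.sum_ite_mem, Finset.univ_inter, Finset.sum_const, S.2,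
    nsmul_eq_mul] at h1
  rw [Nat.cast_choose_two]
  linarith

/-- The matrix expressing the indicators of the events `e \ {h} ⊆ S`, with the constant `1` in the
place of `e₀`, through the indicators of the events `e ⊆ S`. -/
noncomputable def pairTransition (k : ℕ) (h : V) (e₀ : Block V 2) :
    Matrix (Block V 2) (Block V 2) ℝ :=
  Matrix.of fun e f => if e = e₀ then ((k.choose 2 : ℝ))⁻¹ else
    if h ∈ e.1 then (if e.1.erase h ⊆ f.1 then ((k : ℝ) - 1)⁻¹ else 0) else
      if e = f then 1 else 0

theorem pairTransition_mulVec (hk : 2 ≤ k) (S : Block V k) (e : Block V 2) :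
    (pairTransition k h e₀ *ᵥ pairIndicator k S) e =
      if e = e₀ then 1 else if e.1.erase h ⊆ S.1 then 1 else 0 := by
  have hk1 : (k : ℝ) - 1 ≠ 0 := by
    have : (2 : ℝ) ≤ k := by exact_mod_cast hk
    linarith
  simp only [mulVec, dotProduct, pairTransition, Matrix.of_apply]
  by_cases he : e = e₀
  · have : (k.choose 2 : ℝ) ≠ 0 := by exact_mod_cast (Nat.choose_pos hk).ne'
    simp only [he, if_true, ← Finset.mul_sum, sum_pairIndicator]
    exact inv_mul_cancel₀ this
  · by_cases hhe : h ∈ e.1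
    · obtain ⟨i, hi⟩ := Finset.card_eq_one.mp
        (show (e.1.erase h).card = 1 by rw [Finset.card_erase_of_mem hhe, e.2])
      have h1 := congrArg (fun x => ((k : ℝ) - 1)⁻¹ * x) (sum_pairIndicator_mem S i)
      simp only [Finset.mul_sum, mul_ite, mul_zero, inv_mul_cancel₀ hk1] at h1
      simp only [he, hhe, if_true, if_false, hi, Finset.singleton_subset_iff, ite_mul, zero_mul, h1]
    · simp only [he, hhe, if_false, ite_mul, one_mul, zero_mul, Finset.sum_ite_eq,
        Finset.mem_univ, if_true, pairIndicator, Finset.erase_eq_of_notMem hhe]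

theorem card_mem_pair (h : V) :
    Fintype.card {e : Block V 2 // h ∈ e.1} = Fintype.card V - 1 := by
  have h1 := card_block_superset (k := 2) ({h} : Finset V) (by simp)
  simp only [Finset.singleton_subset_iff, Finset.card_singleton] at h1
  rw [Fintype.card_subtype, h1, Nat.choose_one_right]

/-- Subtract from row `e₀` the rows of the pairs through `h`, each times `(k - 1) / (k choose 2)`.
At column `f` these remove `|f \ {h}| / (k choose 2)`, so row `e₀` becomes 0 where `h ∈ f` and `-1 /
(k choose 2)` elsewhere. The matrix is then block triangular. -/
theorem det_pairTransition (hk : 2 ≤ k) (hh : h ∉ e₀.1) : (pairTransition k h e₀).det =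
    -(((k : ℝ) - 1)⁻¹ ^ (Fintype.card V - 1) * (k.choose 2 : ℝ)⁻¹) := by
  have hk1 : (k : ℝ) - 1 ≠ 0 := by
    have : (2 : ℝ) ≤ k := by exact_mod_cast hk
    linarith
  set b : Block V 2 → ℝ := fun f => if h ∈ f.1 then 0 else -(k.choose 2 : ℝ)⁻¹ with hb
  have hrow : ∑ e, (if e = e₀ then (1 : ℝ) else if h ∈ e.1 then
      -(((k : ℝ) - 1) * (k.choose 2 : ℝ)⁻¹) else 0) • pairTransition k h e₀ e = b := by
    funext f
    have hne : ∀ e : Block V 2, h ∈ e.1 → e ≠ e₀ := fun e he hc => hh (hc ▸ he)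
    rw [Finset.sum_apply, ← Finset.add_sum_erase _ _ (Finset.mem_univ e₀)]
    have hsum : ∑ e ∈ Finset.univ.erase e₀, ((if e = e₀ then (1 : ℝ) else if h ∈ e.1 then
        -(((k : ℝ) - 1) * (k.choose 2 : ℝ)⁻¹) else 0) • pairTransition k h e₀ e) f =
        -(k.choose 2 : ℝ)⁻¹ * ∑ e : Block V 2, if h ∈ e.1 then
          (if e.1.erase h ⊆ f.1 then (1 : ℝ) else 0) else 0 := by
      rw [← Finset.add_sum_erase Finset.univ (fun e : Block V 2 => if h ∈ e.1 then
          (if e.1.erase h ⊆ f.1 then (1 : ℝ) else 0) else 0) (Finset.mem_univ e₀), if_neg hh,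
        zero_add, Finset.mul_sum]
      refine Finset.sum_congr rfl fun e he => ?_
      have he' := Finset.ne_of_mem_erase he
      by_cases hhe : h ∈ e.1
      · by_cases hef : e.1.erase h ⊆ f.1
        · simp [he', hhe, hef, pairTransition]
          field_simp
        · simp [he', hhe, hef, pairTransition]
      · simp [he', hhe]
    rw [hsum, sum_mem_eq_sum_pair h fun T => if T.erase h ⊆ f.1 then (1 : ℝ) else 0]
    have hin : ∑ p ∈ Finset.univ.erase h, (if ({h, p} : Finset V).erase h ⊆ f.1 then (1 : ℝ)
        else 0) = (f.1.erase h).card := by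
      have h1 : ∀ p ∈ Finset.univ.erase h, (if ({h, p} : Finset V).erase h ⊆ f.1 then (1 : ℝ)
          else 0) = if p ∈ f.1 then 1 else 0 := fun p hp => by
        have := Finset.ne_of_mem_erase hp
        simp [Finset.erase_insert_eq_erase, Finset.erase_eq_of_notMem, this.symm]
      rw [Finset.sum_congr rfl h1, Finset.sum_ite_mem, Finset.erase_inter, Finset.univ_inter]
      simp
    rw [hin]
    by_cases hf : h ∈ f.1
    · simp [hb, hf, pairTransition, Finset.card_erase_of_mem hf, f.2]
    · simp [hb, hf, pairTransition, f.2]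
      ring
  have hdet := det_updateRow_sum (pairTransition k h e₀) e₀ fun e => if e = e₀ then (1 : ℝ) else
    if h ∈ e.1 then -(((k : ℝ) - 1) * (k.choose 2 : ℝ)⁻¹) else 0
  rw [hrow] at hdet
  simp only [if_true, one_smul] at hdet
  rw [← hdet, twoBlockTriangular_det _ fun e : Block V 2 => h ∈ e.1]
  · have h1 : ((pairTransition k h e₀).updateRow e₀ b).toSquareBlockProp
        (fun e : Block V 2 => h ∈ e.1) = ((k : ℝ) - 1)⁻¹ • 1 := by
      ext e f
      have hne : e.1 ≠ e₀ := fun hc => hh (hc ▸ e.2)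
      have hiff : e.1.1.erase h ⊆ f.1.1 ↔ e = f := by
        constructor
        · intro hs
          have hs' : e.1.1 ⊆ f.1.1 := by
            rw [← Finset.insert_erase e.2]
            exact Finset.insert_subset f.2 hs
          exact Subtype.ext (Subtype.ext (Finset.eq_of_subset_of_card_le hs'
            (by rw [e.1.2, f.1.2])))
        · rintro rfl
          exact Finset.erase_subset _ _
      simp only [toSquareBlockProp_def, Matrix.of_apply, updateRow_ne hne, pairTransition, hne,
        if_false, e.2, if_true, hiff, Matrix.smul_apply, Matrix.one_apply, smul_eq_mul, mul_ite,
        mul_one, mul_zero]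
    have h2 : ((pairTransition k h e₀).updateRow e₀ b).toSquareBlockProp
        (fun e : Block V 2 => ¬ h ∈ e.1) =
        updateRow 1 ⟨e₀, hh⟩ fun _ => -(k.choose 2 : ℝ)⁻¹ := by
      ext e f
      by_cases he : e = ⟨e₀, hh⟩
      · subst he
        simp [toSquareBlockProp_def, hb, f.2]
      · have hne : e.1 ≠ e₀ := fun hc => he (Subtype.ext hc)
        have hiff : e.1 = f.1 ↔ e = f := Subtype.ext_iff.symm
        simp only [toSquareBlockProp_def, Matrix.of_apply, updateRow_ne hne, updateRow_ne he,
          pairTransition, hne, e.2, if_false, Matrix.one_apply, hiff]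
    -- The second block is the identity with one row replaced by a constant, so Cramer's rule reads
    -- off its determinant as that constant.
    rw [h1, h2, det_smul, det_one, ← cramer_transpose_apply, transpose_one, cramer_one,
      card_mem_pair]
    simp
  · intro e he f hf
    by_cases hee : e = e₀
    · subst hee
      simp [hb, hf]
    · have hne : e ≠ f := fun hc => he (hc ▸ hf)
      simp [pairTransition, hee, he, hne]

/-- After the transition, coordinate `e₀` is the constant 1. Adding multiples of its row centres the
others without changing the determinant, and the mean-zero coordinates are then orthogonal to it.
The second moment matrix splits into the covariance and a block 1. -/
theorem det_secondMoment_pairVector (hk : 2 ≤ k) (hkV : k ≤ Fintype.card V) (hh : h ∉ e₀.1) :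
    (secondMoment (pairVector k h e₀)).det =
      (((k : ℝ) - 1)⁻¹ ^ (Fintype.card V - 1) * (k.choose 2 : ℝ)⁻¹) ^ 2 *
        (secondMoment (pairIndicator (V := V) k)).det := by
  have hN : (Fintype.card (Block V k) : ℝ) ≠ 0 := by
    rw [card_block]
    exact_mod_cast (Nat.choose_pos hkV).ne'
  set c : Block V 2 → ℝ := fun e => if e = e₀ then 0 else
    -((k.choose (e.1.erase h).card : ℝ) / (Fintype.card V).choose (e.1.erase h).card) with hc
  set M : Matrix (Block V 2) (Block V 2) ℝ := Matrix.of fun e f =>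
    pairTransition k h e₀ e f + c e * pairTransition k h e₀ e₀ f with hM
  have hMdet : M.det = (pairTransition k h e₀).det :=
    det_eq_of_forall_row_eq_smul_add_const c e₀ (by simp [hc]) fun e f => rfl
  have hMZ : ∀ S e, (M *ᵥ pairIndicator k S) e =
      if he : e ≠ e₀ then pairVector k h e₀ S ⟨e, he⟩ else 1 := by
    intro S e
    have h1 : (M *ᵥ pairIndicator k S) e = (pairTransition k h e₀ *ᵥ pairIndicator k S) e +
        c e * (pairTransition k h e₀ *ᵥ pairIndicator k S) e₀ := by
      simp only [hM, mulVec, dotProduct, Matrix.of_apply, add_mul, Finset.sum_add_distrib,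
        Finset.mul_sum, mul_assoc]
    rw [h1, pairTransition_mulVec hk, pairTransition_mulVec hk, if_pos rfl, mul_one]
    by_cases he : e = e₀
    · simp [he, hc]
    · simp [he, hc, pairVector, sub_eq_add_neg]
  have hG := congrArg Matrix.det (secondMoment_mulVec M (pairIndicator (V := V) k))
  rw [det_mul, det_mul, det_transpose, hMdet, det_pairTransition hk hh,
    twoBlockTriangular_det _ fun e : Block V 2 => e ≠ e₀] at hG
  · have h1 : (secondMoment fun S => M *ᵥ pairIndicator k S).toSquareBlockProp
        (fun e : Block V 2 => e ≠ e₀) = secondMoment (pairVector k h e₀) := by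
      ext e f
      simp only [toSquareBlockProp_def, Matrix.of_apply, secondMoment, hMZ, dif_pos e.2,
        dif_pos f.2]
    have h2 : (secondMoment fun S => M *ᵥ pairIndicator k S).toSquareBlockProp
        (fun e : Block V 2 => ¬ e ≠ e₀) = 1 := by
      ext e f
      have he : e.1 = e₀ := not_not.mp e.2
      have hf : f.1 = e₀ := not_not.mp f.2
      obtain rfl : e = f := Subtype.ext (he.trans hf.symm)
      simp only [toSquareBlockProp_def, Matrix.of_apply, secondMoment, hMZ, dif_neg e.2, Matrix.one_apply_eq, mul_one, Finset.sum_const, Finset.card_univ,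
        nsmul_one, div_self hN]
    rw [h1, h2, det_one, mul_one] at hG
    rw [hG]
    ring
  · intro e he f hf
    simp only [secondMoment, Matrix.of_apply, hMZ, dif_neg he, dif_pos hf, one_mul,
      sum_pairVector hkV, zero_div]

theorem choose_succ_div_choose_succ (a b j : ℕ) : (a.choose (j + 1) : ℝ) / b.choose (j + 1) =
    (a.choose j : ℝ) / b.choose j * ((a - j) / (b - j)) := by
  have h1 : ∀ n : ℕ, (n.choose (j + 1) : ℝ) = n.choose j * (n - j) / (j + 1) := by
    intro n
    rw [eq_div_iff (by positivity)]
    rcases le_or_gt j n with hj | hj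
    · rw [← Nat.cast_sub hj]
      exact_mod_cast Nat.choose_succ_right_eq n j
    · simp [Nat.choose_eq_zero_of_lt hj, Nat.choose_eq_zero_of_lt (hj.trans (Nat.lt_succ_self j))]
  rw [h1, h1, div_div_div_cancel_right₀ (by positivity), mul_div_mul_comm]

theorem det_secondMoment_pairVector_eq_bibdConst (hk : 2 ≤ k) (hV : k + 2 ≤ Fintype.card V)
    (hh : h ∉ e₀.1) :
    (secondMoment (pairVector k h e₀)).det = bibdConst (Fintype.card V) k := by
  rw [det_secondMoment_pairVector hk (by omega) hh, bibdConst]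
  obtain ⟨n, hn⟩ : ∃ n, Fintype.card V = n + 1 := ⟨Fintype.card V - 1, by omega⟩
  obtain ⟨r, hr⟩ : ∃ r, (Fintype.card V).choose 2 = Fintype.card V + r := by
    refine Nat.exists_eq_add_of_le ?_
    rw [Nat.choose_two_right, Nat.le_div_iff_mul_le two_pos]
    exact Nat.mul_le_mul_left _ (by omega)
  have hk2 : (2 : ℝ) ≤ k := by exact_mod_cast hk
  have hkv : (k : ℝ) + 2 ≤ Fintype.card V := by exact_mod_cast hV
  set v := (Fintype.card V : ℝ) with hv
  set q : ℕ → ℝ := fun j => (k.choose j : ℝ) / (Fintype.card V).choose j with hq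
  have hq2 : q 2 = k * (k - 1) / (v * (v - 1)) := choose_two_div_choose_two _ _
  have hq3 : q 3 = q 2 * ((k - 2) / (v - 2)) := by
    have := choose_succ_div_choose_succ k (Fintype.card V) 2
    simpa using this
  have hq4 : q 4 = q 3 * ((k - 3) / (v - 3)) := by
    have := choose_succ_div_choose_succ k (Fintype.card V) 3
    simpa using this
  have h0 : (k : ℝ) ≠ 0 := by linarith
  have h1 : (k : ℝ) - 1 ≠ 0 := by linarith
  have h2 : v - k ≠ 0 := by linarith
  have h3 : v - k - 1 ≠ 0 := by linarith
  have h4 : v ≠ 0 := by linarith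
  have h5 : v - 1 ≠ 0 := by linarith
  have h6 : v - 2 ≠ 0 := by linarith
  have h7 : v - 3 ≠ 0 := by linarith
  set a : ℝ := ((k : ℝ) - 1) * (v - k - 1) / (v - 3) with ha
  set b : ℝ := (k : ℝ) * (v - k) / (v - 2) with hb
  set c : ℝ := 1 / (v * (v - 1)) with hc
  have hdet := det_secondMoment_pairIndicator (V := V) (k := k) (by omega) (by omega) (q := q)
    (fun j => rfl) (α := a * b * c) (κ := ((k : ℝ) - 1) ^ 2 * b * c)
    (μ := (k : ℝ) ^ 2 * (k - 1) ^ 2 / 2 * c) (r := r) (n := n)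
    (by positivity) (by positivity)
    (by rw [hq4, hq3, hq2, ha, hb, hc]; field_simp; ring)
    (by rw [hq4, hq3, hq2, ha, hb, hc, ← hv]; field_simp; ring)
    (by rw [hq4, hq3, hq2, hb, hc, ← hv]; field_simp; ring) hn hr
  -- The powers of `k - 1` from `κ` and from the transition cancel, and `μ` against `(k choose 2)^2`
  -- leaves the factor 2. The exponents are `r = d - v` for `a`, `n + r = d - 1` for `b` and `d` for
  -- `c`.
  rw [hdet, Nat.cast_choose_two ℝ k, hr, hn, Nat.add_sub_cancel]
  have e1 : ((n + 1 + r : ℕ) : ℤ) - ((n + 1 : ℕ) : ℤ) = (r : ℕ) := by push_cast; ring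
  have e2 : ((n + 1 + r : ℕ) : ℤ) - 1 = (n + r : ℕ) := by push_cast; ring
  rw [e1, e2, zpow_natCast, zpow_natCast, mul_pow, mul_pow, mul_pow, mul_pow, pow_add, pow_add,
    pow_add]
  clear_value a b c
  generalize (k : ℝ) - 1 = m at *
  simp only [inv_pow]
  field_simp
  ring

end Covariance

/-- For fixed `v`, `k`, as `t → ∞` through the admissible values, `Ψ_{v,k,t}` is
`(1 + o(1)) * (v choose k)^t / √((2πt)^(d-1) f(v,k))` with `d = v choose 2`. -/
theorem theoremA (v k : ℕ) (hk : 2 ≤ k) (hvk : k + 2 ≤ v) :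
    Asymptotics.IsEquivalent (Filter.atTop ⊓ Filter.principal (admissibleColumns v k))
      (fun t : ℕ => (bibdCount v k t : ℝ))
      (fun t : ℕ => (v.choose k : ℝ) ^ t /
        Real.sqrt ((2 * Real.pi * (t : ℝ)) ^ ((v.choose 2 : ℤ) - 1) * bibdConst v k)) := by
  have hcard : k + 2 ≤ Fintype.card (Fin v) := by simpa using hvk
  -- Any point and any pair avoiding it would serve.
  let h : Fin v := ⟨0, by omega⟩
  let e₀ : Block (Fin v) 2 := ⟨{(⟨1, by omega⟩ : Fin v), (⟨2, by omega⟩ : Fin v)}, Finset.card_pair (by simp)⟩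
  have hh : h ∉ e₀.1 := by simp [h, e₀]
  have : Nonempty (Block (Fin v) k) := by
    rw [← Fintype.card_pos_iff, card_block]
    exact Nat.choose_pos (by omega)
  have hmain := (isAperiodic_pairVector hk hcard hh).isEquivalent_card_sum_eq_zero
    (sum_pairVector (by omega) h e₀) (T := admissibleColumns v k)
    fun t ht w e => exists_int_sum_pairVector ht h e₀ w e
  have hdim : Fintype.card {e : Block (Fin v) 2 // e ≠ e₀} = v.choose 2 - 1 := by
    rw [Fintype.card_subtype_compl, card_block, Fintype.card_fin, Fintype.card_subtype_eq]
  have hpow : ∀ x : ℝ, x ^ ((v.choose 2 : ℤ) - 1) = x ^ (v.choose 2 - 1) := fun x => by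
    have : 1 ≤ v.choose 2 := Nat.choose_pos (by omega)
    rw [← zpow_natCast, Nat.cast_sub this, Nat.cast_one]
  rw [det_secondMoment_pairVector_eq_bibdConst hk hcard hh, hdim, card_block,
    Fintype.card_fin] at hmain
  simp_rw [hpow]
  refine hmain.congr_left ?_
  filter_upwards [(eventually_gt_atTop 0).filter_mono inf_le_left] with t ht
  rw [bibdCount_eq_card hk hvk ht hh]
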